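/- Let $X$ be a (connected, second countable, smooth) Riemannian manifold with distance function $d$ and Riemannian volume measure, and let $C_0(X)$ act on $L^2(X)$ by multiplication. For a metric space $Y$ and a nondegenerate $*$-representation of $C_0(Y)$ on a Hilbert space $H$, an operator $T\in\mathcal B(H)$ is *locally compact* if $fT$ and $Tf$ are compact for every compactly supported $f\in C_0(Y)$, and has *finite propagation* if there is $R>0$ such that $fTg=0$ whenever $d(x,y)\ge R$ for all $x\in\operatorname{supp} f$, $y\in\operatorname{supp} g$. The *Roe algebra* $C^*(Y)=C^*(Y;H)$ is the norm closure of the $*$-algebra of locally compact operators of finite propagation. For the manifold $X$ itself, $H=L^2(X)$. For a closed subset $Y\subseteq X$ with the restricted metric, $H$ is any ample $Y$-module, i.e. a separable Hilbert space with a nondegenerate $*$-representation of $C_0(Y)$ such that no nonzero $f\in C_0(Y)$ acts as a compact operator. $K_0$ denotes operator $K$-theory. A subset $\Gamma\subseteq X$ is *uniformly discrete* if for some $r>0$ the open balls $B_r(\gamma)$, $\gamma\in\Gamma$, are pairwise disjoint; the largest such $r$ is its *packing radius* ($r=\infty$ and $B_\infty(\gamma)=X$ if $\Gamma$ has at most one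 point). A *$\Gamma$-compactly supported Wannier basis* of a closed subspace $\mathcal H\subseteq L^2(X)$ is an orthonormal basis $\{w_\gamma\}_{\gamma\in\Gamma}$ of $\mathcal H$ with $\operatorname{supp}(w_\gamma)\subseteq B_r(\gamma)$ for all $\gamma\in\Gamma$, where $r$ is the packing radius of $\Gamma$. **Proposition.** Suppose that $X=X_1\cup X_2$ with $X_1,X_2$ closed subsets such that $K_0(C^*(X_1))=0$ and $K_0(C^*(X_2))=0$. Let $p\in C^*(X)$ be a projection whose range admits a $\Gamma$-compactly supported Wannier basis for some uniformly discrete $\Gamma\subseteq X$. Then $[p]=0$ in $K_0(C^*(X))$. -/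

import Mathlib

open MeasureTheory Set Topology Bundle Manifold
open scoped ContDiff ENNReal ZeroAtInfty Matrix

noncomputable section

/-! ## Operator K-theory in degree zero -/

namespace KTheory

section Unital

variable (B : Type*) [Ring B] [StarRing B]

/-- A projection in some matrix algebra `M_n(B)`, `n ≥ 0`. -/
structure MatProj where
  size : ℕ
  mat : Matrix (Fin size) (Fin size) B
  isProj : IsStarProjection mat

variable {B}

namespace MatProj

/-- Murray--von Neumann equivalence of projections in matrix algebras of possibly different
sizes: `p = v* v` and `q = v v*` for a rectangular matrix `v`. -/
def MvN (p q : MatProj B) : Prop :=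
  ∃ v : Matrix (Fin q.size) (Fin p.size) B, vᴴ * v = p.mat ∧ v * vᴴ = q.mat

theorem MvN.refl (p : MatProj B) : MvN p p := by
  have h1 : p.matᴴ = p.mat := p.isProj.isSelfAdjoint
  have h2 : p.mat * p.mat = p.mat := p.isProj.isIdempotentElem
  exact ⟨p.mat, by rw [h1, h2], by rw [h1, h2]⟩

theorem MvN.symm {p q : MatProj B} : MvN p q → MvN q p := by
  rintro ⟨v, h1, h2⟩
  exact ⟨vᴴ, by rw [Matrix.conjTranspose_conjTranspose, h2],
    by rw [Matrix.conjTranspose_conjTranspose, h1]⟩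

theorem MvN.trans {p q r : MatProj B} : MvN p q → MvN q r → MvN p r := by
  rintro ⟨v, h1, h2⟩ ⟨w, h3, h4⟩
  have hp : p.mat * p.mat = p.mat := p.isProj.isIdempotentElem
  have hr : r.mat * r.mat = r.mat := r.isProj.isIdempotentElem
  refine ⟨w * v, ?_, ?_⟩
  · calc (w * v)ᴴ * (w * v) = vᴴ * (wᴴ * w) * v := by
          simp only [Matrix.conjTranspose_mul, Matrix.mul_assoc]
      _ = (vᴴ * v) * (vᴴ * v) := by rw [h3, ← h2]; simp only [Matrix.mul_assoc]
      _ = p.mat := by rw [h1, hp]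
  · calc (w * v) * (w * v)ᴴ = w * (v * vᴴ) * wᴴ := by
          simp only [Matrix.conjTranspose_mul, Matrix.mul_assoc]
      _ = (w * wᴴ) * (w * wᴴ) := by rw [h2, ← h3]; simp only [Matrix.mul_assoc]
      _ = r.mat := by rw [h4, hr]

instance setoid (B : Type*) [Ring B] [StarRing B] : Setoid (MatProj B) where
  r := MvN
  iseqv := ⟨MvN.refl, MvN.symm, MvN.trans⟩

/-- The block diagonal sum `p ⊕ q = diag(p, q)`. -/
def dsum (p q : MatProj B) : MatProj B where
  size := p.size + q.size
  mat := Matrix.reindex finSumFinEquiv finSumFinEquiv (Matrix.fromBlocks p.mat 0 0 q.mat)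
  isProj := by
    have hp1 : p.matᴴ = p.mat := p.isProj.isSelfAdjoint
    have hp2 : p.mat * p.mat = p.mat := p.isProj.isIdempotentElem
    have hq1 : q.matᴴ = q.mat := q.isProj.isSelfAdjoint
    have hq2 : q.mat * q.mat = q.mat := q.isProj.isIdempotentElem
    refine ⟨?_, ?_⟩
    · simp only [IsIdempotentElem, Matrix.reindex_apply, Matrix.submatrix_mul_equiv,
        Matrix.fromBlocks_multiply, hp2, hq2, Matrix.mul_zero, Matrix.zero_mul, add_zero, zero_add]
    · simp only [IsSelfAdjoint, Matrix.star_eq_conjTranspose, Matrix.reindex_apply,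
        Matrix.conjTranspose_submatrix, Matrix.fromBlocks_conjTranspose, hp1, hq1,
        Matrix.conjTranspose_zero]

/-- The empty matrix. -/
def zero : MatProj B where
  size := 0
  mat := 0
  isProj := IsStarProjection.zero _

/-- A projection of `B`, as a `1 × 1` matrix. -/
def single (p : B) (hp : IsStarProjection p) : MatProj B where
  size := 1
  mat := Matrix.of fun _ _ => p
  isProj := by
    have h1 : star p = p := hp.isSelfAdjoint
    have h2 : p * p = p := hp.isIdempotentElem
    refine ⟨?_, ?_⟩
    · ext i j; simp [Matrix.mul_apply, h2]
    · ext i j; simp [Matrix.star_apply, h1]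

/-- A criterion for equivalence in terms of matrices with arbitrary finite index types. -/
theorem mvN_of_reindex {p q : MatProj B} {m n : Type*} [Fintype m] [Fintype n]
    (e : m ≃ Fin p.size) (f : n ≃ Fin q.size) (v : Matrix n m B)
    (h1 : Matrix.reindex e e (vᴴ * v) = p.mat) (h2 : Matrix.reindex f f (v * vᴴ) = q.mat) :
    MvN p q := by
  refine ⟨Matrix.reindex f e v, ?_, ?_⟩
  · rw [← h1]
    simp only [Matrix.reindex_apply, Matrix.conjTranspose_submatrix, Matrix.submatrix_mul_equiv]
  · rw [← h2]
    simp only [Matrix.reindex_apply, Matrix.conjTranspose_submatrix, Matrix.submatrix_mul_equiv]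

theorem mvN_of_eq_reindex {p q : MatProj B} (e : Fin p.size ≃ Fin q.size)
    (h : q.mat = Matrix.reindex e e p.mat) : MvN p q := by
  have hp1 : p.matᴴ = p.mat := p.isProj.isSelfAdjoint
  have hp2 : p.mat * p.mat = p.mat := p.isProj.isIdempotentElem
  refine mvN_of_reindex (Equiv.refl _) e p.mat ?_ ?_
  · rw [hp1, hp2]; rfl
  · rw [hp1, hp2, h]

theorem MvN.dsum {p q p' q' : MatProj B} (h : MvN p p') (h' : MvN q q') :
    MvN (p.dsum q) (p'.dsum q') := by
  obtain ⟨v, h1, h2⟩ := h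
  obtain ⟨w, h3, h4⟩ := h'
  refine mvN_of_reindex finSumFinEquiv finSumFinEquiv (Matrix.fromBlocks v 0 0 w) ?_ ?_
  · simp only [Matrix.fromBlocks_conjTranspose, Matrix.fromBlocks_multiply, h1, h3,
      Matrix.conjTranspose_zero, Matrix.mul_zero, Matrix.zero_mul, add_zero, zero_add]
    rfl
  · simp only [Matrix.fromBlocks_conjTranspose, Matrix.fromBlocks_multiply, h2, h4,
      Matrix.conjTranspose_zero, Matrix.mul_zero, Matrix.zero_mul, add_zero, zero_add]
    rfl

theorem dsum_comm (p q : MatProj B) : MvN (p.dsum q) (q.dsum p) := by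
  let e : Fin (p.size + q.size) ≃ Fin (q.size + p.size) :=
    (finSumFinEquiv.symm.trans (Equiv.sumComm _ _)).trans finSumFinEquiv
  have key : Matrix.reindex finSumFinEquiv finSumFinEquiv (Matrix.fromBlocks q.mat 0 0 p.mat)
      = Matrix.reindex e e
        (Matrix.reindex finSumFinEquiv finSumFinEquiv (Matrix.fromBlocks p.mat 0 0 q.mat)) := by
    ext i j
    obtain ⟨i, rfl⟩ := finSumFinEquiv.surjective i
    obtain ⟨j, rfl⟩ := finSumFinEquiv.surjective j
    rcases i with i | i <;> rcases j with j | j <;> simp [e]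
  exact mvN_of_eq_reindex e key

theorem dsum_assoc (p q r : MatProj B) :
    MvN ((p.dsum q).dsum r) (p.dsum (q.dsum r)) := by
  let e : Fin (p.size + q.size + r.size) ≃ Fin (p.size + (q.size + r.size)) :=
    (((finSumFinEquiv.symm.trans (Equiv.sumCongr finSumFinEquiv.symm (Equiv.refl _))).trans
      (Equiv.sumAssoc _ _ _)).trans (Equiv.sumCongr (Equiv.refl _) finSumFinEquiv)).trans
      finSumFinEquiv
  have key : Matrix.reindex finSumFinEquiv finSumFinEquiv (Matrix.fromBlocks p.mat 0 0
        (Matrix.reindex finSumFinEquiv finSumFinEquiv (Matrix.fromBlocks q.mat 0 0 r.mat)))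
      = Matrix.reindex e e (Matrix.reindex finSumFinEquiv finSumFinEquiv (Matrix.fromBlocks
        (Matrix.reindex finSumFinEquiv finSumFinEquiv (Matrix.fromBlocks p.mat 0 0 q.mat))
        0 0 r.mat)) := by
    ext i j
    obtain ⟨i, rfl⟩ := finSumFinEquiv.surjective i
    obtain ⟨j, rfl⟩ := finSumFinEquiv.surjective j
    rcases i with i | i <;> rcases j with j | j
    · simp [e]
    · obtain ⟨j, rfl⟩ := finSumFinEquiv.surjective j
      rcases j with j | j <;> simp [e]
    · obtain ⟨i, rfl⟩ := finSumFinEquiv.surjective i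
      rcases i with i | i <;> simp [e]
    · obtain ⟨i, rfl⟩ := finSumFinEquiv.surjective i
      obtain ⟨j, rfl⟩ := finSumFinEquiv.surjective j
      rcases i with i | i <;> rcases j with j | j <;> simp [e]
  exact mvN_of_eq_reindex e key

theorem zero_dsum (p : MatProj B) : MvN (zero.dsum p) p := by
  let e : Fin (0 + p.size) ≃ Fin p.size :=
    finSumFinEquiv.symm.trans (Equiv.emptySum (Fin 0) _)
  have key : p.mat = Matrix.reindex e e (Matrix.reindex finSumFinEquiv finSumFinEquiv
      (Matrix.fromBlocks (0 : Matrix (Fin 0) (Fin 0) B) 0 0 p.mat)) := by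
    ext i j
    simp [e, -finSumFinEquiv_apply_right]
  exact mvN_of_eq_reindex e key

/-- A projection which is a zero matrix is equivalent to the empty matrix. -/
theorem mvN_zero_of_mat_eq_zero (p : MatProj B) (h : p.mat = 0) : MvN p zero :=
  ⟨0, by rw [h, Matrix.mul_zero], Subsingleton.elim (α := Matrix (Fin 0) (Fin 0) B) _ _⟩

/-- The entrywise image of a projection under a `*`-homomorphism. -/
def map {C : Type*} [Ring C] [StarRing C] {F : Type*} [FunLike F B C] [RingHomClass F B C]
    [StarHomClass F B C] (φ : F) (p : MatProj B) : MatProj C where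
  size := p.size
  mat := p.mat.map φ
  isProj := by
    have hp1 : p.matᴴ = p.mat := p.isProj.isSelfAdjoint
    have hp2 : p.mat * p.mat = p.mat := p.isProj.isIdempotentElem
    refine ⟨?_, ?_⟩
    · rw [IsIdempotentElem, ← Matrix.map_mul, hp2]
    · rw [IsSelfAdjoint, Matrix.star_eq_conjTranspose,
        ← Matrix.conjTranspose_map _ (fun x => map_star φ x), hp1]

theorem MvN.map {C : Type*} [Ring C] [StarRing C] {F : Type*} [FunLike F B C] [RingHomClass F B C]
    [StarHomClass F B C] (φ : F) {p q : MatProj B} (h : MvN p q) : MvN (p.map φ) (q.map φ) := by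
  obtain ⟨v, h1, h2⟩ := h
  have e1 : (v.map φ)ᴴ * v.map φ = p.mat.map φ := by
    rw [← Matrix.conjTranspose_map _ (fun x => map_star φ x), ← Matrix.map_mul, h1]
  have e2 : v.map φ * (v.map φ)ᴴ = q.mat.map φ := by
    rw [← Matrix.conjTranspose_map _ (fun x => map_star φ x), ← Matrix.map_mul, h2]
  exact ⟨v.map φ, e1, e2⟩

theorem map_dsum {C : Type*} [Ring C] [StarRing C] {F : Type*} [FunLike F B C] [RingHomClass F B C]
    [StarHomClass F B C] (φ : F) (p q : MatProj B) :
    (p.dsum q).map φ = (p.map φ).dsum (q.map φ) := by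
  have key : (Matrix.reindex finSumFinEquiv finSumFinEquiv
      (Matrix.fromBlocks p.mat 0 0 q.mat)).map φ = Matrix.reindex finSumFinEquiv finSumFinEquiv
        (Matrix.fromBlocks (p.mat.map φ) 0 0 (q.mat.map φ)) := by
    ext i j
    obtain ⟨i, rfl⟩ := finSumFinEquiv.surjective i
    obtain ⟨j, rfl⟩ := finSumFinEquiv.surjective j
    rcases i with i | i <;> rcases j with j | j <;> simp
  simp only [MatProj.map, MatProj.dsum, MatProj.mk.injEq, heq_eq_eq, true_and]
  exact key

end MatProj

variable (B) in
/-- The abelian monoid `V(B)` of equivalence classes of projections in matrices over `B`. -/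
def V : Type _ := Quotient (MatProj.setoid B)

namespace V

/-- The class of a projection in `V(B)`. -/
def mk (p : MatProj B) : V B := Quotient.mk _ p

instance : Zero (V B) := ⟨mk MatProj.zero⟩

instance : Add (V B) :=
  ⟨Quotient.map₂ MatProj.dsum fun _ _ h _ _ h' => MatProj.MvN.dsum h h'⟩

instance : AddCommMonoid (V B) where
  nsmul := nsmulRec
  add_assoc := by
    rintro ⟨p⟩ ⟨q⟩ ⟨r⟩
    exact Quotient.sound (MatProj.dsum_assoc p q r)
  add_comm := by
    rintro ⟨p⟩ ⟨q⟩
    exact Quotient.sound (MatProj.dsum_comm p q)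
  zero_add := by
    rintro ⟨p⟩
    exact Quotient.sound (MatProj.zero_dsum p)
  add_zero := by
    rintro ⟨p⟩
    exact Quotient.sound ((MatProj.dsum_comm p _).trans (MatProj.zero_dsum p))

/-- The map `V(B) → V(C)` induced by a `*`-homomorphism. -/
def map {C : Type*} [Ring C] [StarRing C] {F : Type*} [FunLike F B C] [RingHomClass F B C]
    [StarHomClass F B C] (φ : F) : V B →+ V C where
  toFun := Quotient.map (MatProj.map φ) fun _ _ h => MatProj.MvN.map φ h
  map_zero' := Quotient.sound
    (MatProj.mvN_zero_of_mat_eq_zero _ (Subsingleton.elim (α := Matrix (Fin 0) (Fin 0) C) _ _))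
  map_add' := by
    rintro ⟨p⟩ ⟨q⟩
    exact congrArg mk (MatProj.map_dsum φ p q)

end V

variable (B) in
/-- `K₀` of a unital `C*`-algebra: the Grothendieck group of `V(B)`. -/
abbrev UnitalK0 : Type _ := Algebra.GrothendieckAddGroup (V B)

/-- The class of a matrix projection in `K₀(B)`, for unital `B`. -/
def UnitalK0.mk (p : MatProj B) : UnitalK0 B := Algebra.GrothendieckAddGroup.of (V.mk p)

/-- The homomorphism `K₀(B) → K₀(C)` induced by a unital `*`-homomorphism. -/
def UnitalK0.map {C : Type*} [Ring C] [StarRing C] {F : Type*} [FunLike F B C]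
    [RingHomClass F B C] [StarHomClass F B C] (φ : F) : UnitalK0 B →+ UnitalK0 C :=
  Algebra.GrothendieckAddGroup.lift (Algebra.GrothendieckAddGroup.of.comp (V.map φ))

end Unital

section NonUnital

theorem isStarProjection_inr {A : Type*} [NonUnitalRing A] [StarRing A] [Module ℂ A] {p : A}
     (hp : IsStarProjection p) :
    IsStarProjection (p : Unitization ℂ A) where
  isIdempotentElem := by
    have h : p * p = p := hp.isIdempotentElem
    rw [IsIdempotentElem, ← Unitization.inr_mul, h]
  isSelfAdjoint := by
    have h : star p = p := hp.isSelfAdjoint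
    rw [IsSelfAdjoint, ← Unitization.inr_star, h]

variable (A : Type*) [NonUnitalRing A] [StarRing A] [Module ℂ A] [IsScalarTower ℂ A A]
  [SMulCommClass ℂ A A] [StarModule ℂ A]

/-- The character `A⁺ → ℂ`, `(z, a) ↦ z`, of the unitization `A⁺ = ℂ ⊕ A`. -/
def scalarPart : Unitization ℂ A →⋆ₐ[ℂ] ℂ :=
  { Unitization.fstHom ℂ A with map_star' := fun x => Unitization.fst_star x }

/-- `K₀` of a (not necessarily unital) `C*`-algebra: the kernel of `K₀(A⁺) → K₀(ℂ)`. -/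
def K0 : AddSubgroup (UnitalK0 (Unitization ℂ A)) := (UnitalK0.map (scalarPart A)).ker

variable {A}

/-- The class `[p] ∈ K₀(A)` of a projection `p ∈ A`. -/
def projClass (p : A) (hp : IsStarProjection p) : K0 A :=
  ⟨UnitalK0.mk (MatProj.single (p : Unitization ℂ A) (isStarProjection_inr hp)), by
    have h : V.map (scalarPart A) (V.mk (MatProj.single (p : Unitization ℂ A)
        (isStarProjection_inr hp))) = 0 := by
      refine Quotient.sound (MatProj.mvN_zero_of_mat_eq_zero _ ?_)
      ext i j
      exact Unitization.fst_inr ℂ p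
    have h' := DFunLike.congr_fun (Algebra.GrothendieckAddGroup.lift.symm_apply_apply
      (Algebra.GrothendieckAddGroup.of.comp (V.map (scalarPart A))))
      (V.mk (MatProj.single (p : Unitization ℂ A) (isStarProjection_inr hp)))
    rw [AddMonoidHom.comp_apply, h, map_zero] at h'
    exact h'⟩

end NonUnital

end KTheory

/-! ## Roe algebras of `X`-modules -/

namespace Coarse

section Module

variable {X : Type*} [MetricSpace X] {H : Type*} [NormedAddCommGroup H] [InnerProductSpace ℂ H]
  [CompleteSpace H] (ρ : C₀(X, ℂ) →⋆ₙₐ[ℂ] (H →L[ℂ] H))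

/-- An ample `X`-module: a separable Hilbert space with a nondegenerate `*`-representation of
`C₀(X)` in which no nonzero function acts as a compact operator. -/
structure IsAmple : Prop where
  separable : TopologicalSpace.SeparableSpace H
  nondegenerate : Dense (Submodule.span ℂ {v : H | ∃ f h, ρ f h = v} : Set H)
  not_compact : ∀ f : C₀(X, ℂ), f ≠ 0 → ¬ IsCompactOperator (ρ f)

/-- `T` is locally compact: `fT` and `Tf` are compact for every compactly supported `f`. -/
def IsLocallyCompact (T : H →L[ℂ] H) : Prop :=
  ∀ f : C₀(X, ℂ), HasCompactSupport f →
    IsCompactOperator (ρ f * T) ∧ IsCompactOperator (T * ρ f)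

/-- `T` has finite propagation: for some `R > 0`, `fTg = 0` whenever the supports of `f` and `g`
are a distance `R` or more apart. -/
def HasFinitePropagation (T : H →L[ℂ] H) : Prop :=
  ∃ R : ℝ, 0 < R ∧ ∀ f g : C₀(X, ℂ),
    (∀ x ∈ tsupport f, ∀ y ∈ tsupport g, R ≤ dist x y) → ρ f * T * ρ g = 0

/-- The Roe algebra `C*(X)` of an `X`-module: the norm closure of the `*`-algebra of locally
compact operators of finite propagation. (If the module is nondegenerate, these operators already
form a `*`-algebra, so that taking the generated `*`-algebra adds nothing.) -/
def roeAlgebra : NonUnitalStarSubalgebra ℂ (H →L[ℂ] H) :=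
  (NonUnitalStarAlgebra.adjoin ℂ
    {T : H →L[ℂ] H | IsLocallyCompact ρ T ∧ HasFinitePropagation ρ T}).topologicalClosure

end Module

section Multiplication

variable {X : Type*} [TopologicalSpace X] [MeasurableSpace X] [BorelSpace X]

theorem memLp_mul (μ : Measure X) (f : C₀(X, ℂ)) (g : Lp ℂ 2 μ) :
    MemLp (fun x => f x * g x) 2 μ := by
  refine (Lp.memLp g).of_le_mul (c := ‖f.toBCF‖)
    (f.continuous.aestronglyMeasurable.mul (Lp.aestronglyMeasurable g)) ?_
  filter_upwards with x
  rw [norm_mul]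
  gcongr
  exact f.toBCF.norm_coe_le_norm x

/-- The operator on `L²(X, μ)` of multiplication by `f ∈ C₀(X)`. -/
def mulOp (μ : Measure X) (f : C₀(X, ℂ)) : Lp ℂ 2 μ →L[ℂ] Lp ℂ 2 μ :=
  LinearMap.mkContinuous
    { toFun := fun g => (memLp_mul μ f g).toLp _
      map_add' := fun g h => by
        rw [← MemLp.toLp_add]
        refine MemLp.toLp_congr _ _ ?_
        filter_upwards [Lp.coeFn_add g h] with x hx
        simp only [hx, Pi.add_apply, mul_add]
      map_smul' := fun c g => by
        rw [RingHom.id_apply, ← MemLp.toLp_const_smul]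
        refine MemLp.toLp_congr _ _ ?_
        filter_upwards [Lp.coeFn_smul c g] with x hx
        simp only [hx, Pi.smul_apply, smul_eq_mul]
        ring }
    ‖f.toBCF‖ (fun g => by
      refine Lp.norm_le_mul_norm_of_ae_le_mul ?_
      filter_upwards [(memLp_mul μ f g).coeFn_toLp] with x hx
      change ‖((memLp_mul μ f g).toLp _ : X → ℂ) x‖ ≤ _
      rw [hx, norm_mul]
      gcongr
      exact f.toBCF.norm_coe_le_norm x)

theorem coeFn_mulOp (μ : Measure X) (f : C₀(X, ℂ)) (g : Lp ℂ 2 μ) :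
    mulOp μ f g =ᵐ[μ] fun x => f x * g x :=
  (memLp_mul μ f g).coeFn_toLp

/-- The representation of `C₀(X)` on `L²(X, μ)` by multiplication operators. -/
def mulRep (μ : Measure X) : C₀(X, ℂ) →⋆ₙₐ[ℂ] (Lp ℂ 2 μ →L[ℂ] Lp ℂ 2 μ) where
  toFun := mulOp μ
  map_smul' c f := by
    ext1 g
    refine Lp.ext ?_
    filter_upwards [coeFn_mulOp μ (c • f) g, Lp.coeFn_smul c (mulOp μ f g), coeFn_mulOp μ f g]
      with x h1 h2 h3
    change (mulOp μ (c • f) g) x = (c • mulOp μ f g : Lp ℂ 2 μ) x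
    rw [h1, h2, Pi.smul_apply, h3, ZeroAtInftyContinuousMap.smul_apply, smul_eq_mul, smul_eq_mul,
      mul_assoc]
  map_zero' := by
    ext1 g
    refine Lp.ext ?_
    filter_upwards [coeFn_mulOp μ 0 g, Lp.coeFn_zero ℂ 2 μ] with x h1 h2
    change (mulOp μ 0 g) x = (0 : Lp ℂ 2 μ) x
    rw [h1, h2]
    simp
  map_add' f f' := by
    ext1 g
    refine Lp.ext ?_
    filter_upwards [coeFn_mulOp μ (f + f') g, coeFn_mulOp μ f g, coeFn_mulOp μ f' g,
      Lp.coeFn_add (mulOp μ f g) (mulOp μ f' g)] with x h1 h2 h3 h4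
    change (mulOp μ (f + f') g) x = (mulOp μ f g + mulOp μ f' g : Lp ℂ 2 μ) x
    rw [h1, h4, Pi.add_apply, h2, h3, ZeroAtInftyContinuousMap.add_apply, add_mul]
  map_mul' f f' := by
    ext1 g
    refine Lp.ext ?_
    filter_upwards [coeFn_mulOp μ (f * f') g, coeFn_mulOp μ f (mulOp μ f' g),
      coeFn_mulOp μ f' g] with x h1 h2 h3
    change (mulOp μ (f * f') g) x = (mulOp μ f (mulOp μ f' g)) x
    rw [h1, h2, h3, ZeroAtInftyContinuousMap.mul_apply, mul_assoc]
  map_star' f := by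
    rw [ContinuousLinearMap.star_eq_adjoint, ContinuousLinearMap.eq_adjoint_iff]
    intro g h
    rw [L2.inner_def, L2.inner_def]
    refine integral_congr_ae ?_
    filter_upwards [coeFn_mulOp μ (star f) g, coeFn_mulOp μ f h] with x h1 h2
    simp only [h1, h2, ZeroAtInftyContinuousMap.star_apply, RCLike.inner_apply, map_mul,
      RCLike.star_def, RCLike.conj_conj]
    ring

/-- The (essential) support of the class of `g`: the complement of the largest open set on which
`g` vanishes almost everywhere. -/
def essSupport (μ : Measure X) (g : X → ℂ) : Set X :=
  {x | ∀ U ∈ 𝓝 x, μ (U ∩ Function.support g) ≠ 0}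

end Multiplication

section UniformlyDiscrete

variable {X : Type*} [MetricSpace X]

/-- `Γ` is uniformly discrete: for some `r > 0` the open balls `B_r(γ)`, `γ ∈ Γ`, are disjoint. -/
def UniformlyDiscrete (Γ : Set X) : Prop :=
  ∃ r : ℝ, 0 < r ∧ Γ.PairwiseDisjoint fun γ => Metric.ball γ r

/-- The packing radius of `Γ`: the largest `r` such that the open balls `B_r(γ)`, `γ ∈ Γ`, are
disjoint. It is `∞` if `Γ` has at most one point. -/
def packingRadius (Γ : Set X) : ℝ≥0∞ :=
  sSup {r : ℝ≥0∞ | Γ.PairwiseDisjoint fun γ => Metric.eball γ r}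

/-- `w` is a `Γ`-compactly supported Wannier basis for the subspace `S` of `L²(X, μ)`: an
orthonormal basis of `S` indexed by `Γ`, with `supp w_γ ⊆ B_r(γ)` for the packing radius `r`. -/
structure IsWannierBasis [MeasurableSpace X] [BorelSpace X] (μ : Measure X) (Γ : Set X)
    (S : Submodule ℂ (Lp ℂ 2 μ)) (w : Γ → Lp ℂ 2 μ) : Prop where
  orthonormal : Orthonormal ℂ w
  span_eq : (Submodule.span ℂ (Set.range w)).topologicalClosure = S
  support_subset : ∀ γ : Γ, essSupport μ (w γ) ⊆ Metric.eball (γ : X) (packingRadius Γ)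

end UniformlyDiscrete

/-! ## The Riemannian volume measure -/

section Volume

variable {n : ℕ} {M : Type*} [TopologicalSpace M] [ChartedSpace (EuclideanSpace ℝ (Fin n)) M]

variable (n M) in
theorem exists_countable_chart_cover [SecondCountableTopology M] :
    ∃ s : Set M, s.Countable ∧
      ⋃ c ∈ s, (chartAt (EuclideanSpace ℝ (Fin n)) c).source = univ :=
  TopologicalSpace.countable_cover_nhds fun c => chart_source_mem_nhds _ c

variable (n M) in
/-- Centres of countably many charts covering the manifold. -/
def chartCenters [SecondCountableTopology M] : Set M :=
  (exists_countable_chart_cover n M).choose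

instance [SecondCountableTopology M] : Encodable (chartCenters n M) :=
  (exists_countable_chart_cover n M).choose_spec.1.toEncodable

/-- The part of the chart domain at `c` not covered by the chart domains earlier in the
enumeration. These sets form a partition of the manifold. -/
def chartPiece [SecondCountableTopology M] (c : chartCenters n M) : Set M :=
  {x ∈ (chartAt (EuclideanSpace ℝ (Fin n)) (c : M)).source |
    ∀ c' : chartCenters n M, Encodable.encode c' < Encodable.encode c →
      x ∉ (chartAt (EuclideanSpace ℝ (Fin n)) (c' : M)).source}

variable [RiemannianBundle (fun x : M => TangentSpace (𝓡 n) x)]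

/-- The coordinate vector field `∂ᵢ` of the preferred chart at `c`, at the point with
coordinates `u`. -/
def coordField (c : M) (u : EuclideanSpace ℝ (Fin n)) (i : Fin n) :
    TangentSpace (𝓡 n) ((chartAt (EuclideanSpace ℝ (Fin n)) c).symm u) :=
  mfderiv (𝓡 n) (𝓡 n) (chartAt (EuclideanSpace ℝ (Fin n)) c).symm u (EuclideanSpace.single i 1)

/-- The matrix `gᵢⱼ = ⟨∂ᵢ, ∂ⱼ⟩` of the metric in the preferred chart at `c`. -/
def metricMatrix (c : M) (u : EuclideanSpace ℝ (Fin n)) : Matrix (Fin n) (Fin n) ℝ :=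
  Matrix.of fun i j => inner ℝ (coordField c u i) (coordField c u j)

/-- The measure `√(det gᵢⱼ) du₁ ⋯ duₙ` on the domain of the preferred chart at `c`. -/
def chartVolume [MeasurableSpace M] (c : M) : Measure M :=
  ((volume.restrict (chartAt (EuclideanSpace ℝ (Fin n)) c).target).withDensity
    fun u => ENNReal.ofReal (Real.sqrt (metricMatrix c u).det)).map
      (chartAt (EuclideanSpace ℝ (Fin n)) c).symm

variable (n M) in
/-- The Riemannian volume measure. It is `√(det gᵢⱼ) du₁ ⋯ duₙ` in each chart, and is obtained
here by adding up the contributions of a countable partition subordinate to charts (by the change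
of variables formula, the result does not depend on the choice). -/
def riemannianVolume [SecondCountableTopology M] [MeasurableSpace M] : Measure M :=
  Measure.sum fun c : chartCenters n M => (chartVolume (n := n) (c : M)).restrict (chartPiece c)

end Volume

end Coarse

end

noncomputable section

namespace KTheory

section Unital

variable {B : Type*} [Ring B] [StarRing B]

theorem UnitalK0.mk_eq_of_mvN {p q : MatProj B} (h : MatProj.MvN p q) :
    UnitalK0.mk p = UnitalK0.mk q :=
  congrArg Algebra.GrothendieckAddGroup.of (Quotient.sound h : V.mk p = V.mk q)

theorem UnitalK0.mk_dsum (p q : MatProj B) :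
    UnitalK0.mk (p.dsum q) = UnitalK0.mk p + UnitalK0.mk q :=
  map_add Algebra.GrothendieckAddGroup.of (V.mk p) (V.mk q)

theorem UnitalK0.mk_eq_zero_of_mat_eq_zero {p : MatProj B} (h : p.mat = 0) :
    UnitalK0.mk p = 0 :=
  (UnitalK0.mk_eq_of_mvN (p.mvN_zero_of_mat_eq_zero h)).trans
    (map_zero Algebra.GrothendieckAddGroup.of)

theorem UnitalK0.map_mk {C : Type*} [Ring C] [StarRing C] {F : Type*} [FunLike F B C]
    [RingHomClass F B C] [StarHomClass F B C] (φ : F) (p : MatProj B) :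
    UnitalK0.map φ (UnitalK0.mk p) = UnitalK0.mk (p.map φ) :=
  DFunLike.congr_fun (Algebra.GrothendieckAddGroup.lift.symm_apply_apply
    (Algebra.GrothendieckAddGroup.of.comp (V.map φ))) (V.mk p)

/-- A class vanishes in `K₀` exactly when it is stably trivial. -/
theorem UnitalK0.exists_dsum_mvN_of_mk_eq_zero {p : MatProj B} (h : UnitalK0.mk p = 0) :
    ∃ r : MatProj B, MatProj.MvN (p.dsum r) r := by
  have h' : Algebra.GrothendieckAddGroup.of (V.mk p) = Algebra.GrothendieckAddGroup.of 0 := by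
    rw [map_zero]; exact h
  obtain ⟨c, hc⟩ := (AddLocalization.addMonoidOf (⊤ : AddSubmonoid (V B))).eq_iff_exists.1 h'
  obtain ⟨r, hr⟩ := Quotient.exists_rep (c : V B)
  refine ⟨r, (MatProj.dsum_comm p r).trans (Quotient.exact (s := MatProj.setoid B) ?_)⟩
  have h1 : (c : V B) + V.mk p = c := by rw [hc, add_zero]
  rw [← hr] at h1
  exact h1

theorem MatProj.single_mvN {p q : B} (hp : IsStarProjection p) (hq : IsStarProjection q) (u : B)
    (h1 : star u * u = p) (h2 : u * star u = q) :
    MatProj.MvN (MatProj.single p hp) (MatProj.single q hq) := by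
  have e1 : (Matrix.of fun (_ _ : Fin 1) => u)ᴴ * (Matrix.of fun (_ _ : Fin 1) => u)
      = Matrix.of fun _ _ => p := by
    ext i j; simp [Matrix.mul_apply, h1]
  have e2 : (Matrix.of fun (_ _ : Fin 1) => u) * (Matrix.of fun (_ _ : Fin 1) => u)ᴴ
      = Matrix.of fun _ _ => q := by
    ext i j; simp [Matrix.mul_apply, h2]
  exact ⟨Matrix.of fun (_ _ : Fin 1) => u, e1, e2⟩

/-- The sum of two orthogonal projections is equivalent to their direct sum. -/
theorem MatProj.single_add_mvN {p q r : B} (hp : IsStarProjection p) (hq : IsStarProjection q)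
    (hr : IsStarProjection r) (h : p + q = r) (h0 : p * q = 0) :
    MatProj.MvN (MatProj.single r hr) ((MatProj.single p hp).dsum (MatProj.single q hq)) := by
  have hp1 : star p = p := hp.isSelfAdjoint
  have hq1 : star q = q := hq.isSelfAdjoint
  have hp2 : p * p = p := hp.isIdempotentElem
  have hq2 : q * q = q := hq.isIdempotentElem
  have h0' : q * p = 0 := by
    have := congrArg star h0
    rwa [star_mul, hp1, hq1, star_zero] at this
  refine MatProj.mvN_of_reindex (m := Fin 1) (n := Fin 1 ⊕ Fin 1) (Equiv.refl _) finSumFinEquiv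
    (Matrix.of fun i _ => Sum.elim (fun _ => p) (fun _ => q) i) ?_ ?_
  · have e : (Matrix.of fun (i : Fin 1 ⊕ Fin 1) (_ : Fin 1) =>
          (Sum.elim (fun _ => p) (fun _ => q) i : B))ᴴ *
          (Matrix.of fun (i : Fin 1 ⊕ Fin 1) (_ : Fin 1) => Sum.elim (fun _ => p) (fun _ => q) i)
          = Matrix.of fun _ _ => r := by
      ext i j
      simp [Matrix.mul_apply, hp1, hq1, hp2, hq2, h]
    rw [e]
    rfl
  · change _ = Matrix.reindex finSumFinEquiv finSumFinEquiv
      (Matrix.fromBlocks (Matrix.of fun _ _ => p) 0 0 (Matrix.of fun _ _ => q))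
    congr 1
    ext i j
    rcases i with i | i <;> rcases j with j | j <;>
      simp [Matrix.mul_apply, hp1, hq1, hp2, hq2, h0, h0'] <;> rfl

end Unital

section NonUnital

variable {A : Type*} [NonUnitalRing A] [StarRing A] [Module ℂ A] [IsScalarTower ℂ A A]
  [SMulCommClass ℂ A A] [StarModule ℂ A]

theorem projClass_eq_zero_iff {p : A} (hp : IsStarProjection p) :
    projClass p hp = 0 ↔
      UnitalK0.mk (MatProj.single (p : Unitization ℂ A) (isStarProjection_inr hp)) = 0 :=
  Subtype.ext_iff

theorem projClass_zero_of_eq_zero {p : A} (hp : IsStarProjection p) (h : p = 0) :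
    projClass p hp = 0 := by
  rw [projClass_eq_zero_iff]
  refine UnitalK0.mk_eq_zero_of_mat_eq_zero ?_
  subst h
  exact Matrix.ext fun _ _ => Unitization.inr_zero ℂ

/-- Murray--von Neumann equivalent projections of `A` have the same class. -/
theorem projClass_eq_zero_of_equiv {p q : A} (hp : IsStarProjection p) (hq : IsStarProjection q)
    (u : A) (h1 : star u * u = p) (h2 : u * star u = q) (h : projClass p hp = 0) :
    projClass q hq = 0 := by
  rw [projClass_eq_zero_iff] at h ⊢
  rw [← h]
  refine (UnitalK0.mk_eq_of_mvN (MatProj.single_mvN _ _ (u : Unitization ℂ A) ?_ ?_)).symm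
  · rw [← Unitization.inr_star, ← Unitization.inr_mul, h1]
  · rw [← Unitization.inr_star, ← Unitization.inr_mul, h2]

theorem projClass_eq_zero_of_add {p q r : A} (hp : IsStarProjection p) (hq : IsStarProjection q)
    (hr : IsStarProjection r) (h : p + q = r) (h0 : p * q = 0) (h1 : projClass p hp = 0)
    (h2 : projClass q hq = 0) : projClass r hr = 0 := by
  rw [projClass_eq_zero_iff] at h1 h2 ⊢
  rw [UnitalK0.mk_eq_of_mvN (MatProj.single_add_mvN (isStarProjection_inr hp)
    (isStarProjection_inr hq) (isStarProjection_inr hr) ?_ ?_), UnitalK0.mk_dsum, h1, h2, add_zero]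
  · rw [← Unitization.inr_add, h]
  · rw [← Unitization.inr_mul, h0, Unitization.inr_zero]

theorem projClass_map_eq_zero {A' : Type*} [NonUnitalRing A'] [StarRing A'] [Module ℂ A']
    [IsScalarTower ℂ A' A'] [SMulCommClass ℂ A' A'] [StarModule ℂ A'] (φ : A →⋆ₙₐ[ℂ] A') {p : A}
    (hp : IsStarProjection p) (hq : IsStarProjection (φ p)) (h : projClass p hp = 0) :
    projClass (φ p) hq = 0 := by
  rw [projClass_eq_zero_iff] at h ⊢
  have h' := congrArg (UnitalK0.map (Unitization.starMap φ)) h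
  rw [map_zero, UnitalK0.map_mk] at h'
  refine Eq.trans ?_ h'
  congr 1
  have key : (Matrix.of fun (_ _ : Fin 1) => ((φ p : A') : Unitization ℂ A'))
      = (Matrix.of fun (_ _ : Fin 1) => (p : Unitization ℂ A)).map (Unitization.starMap φ) := by
    ext1 i j
    exact (Unitization.starMap_inr φ p).symm
  simp only [MatProj.map, MatProj.single, MatProj.mk.injEq, heq_eq_eq, true_and]
  exact key

end NonUnital

end KTheory

namespace Coarse

section CompactAdjoint

variable {E F : Type*} [NormedAddCommGroup E] [InnerProductSpace ℂ E] [CompleteSpace E]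
  [NormedAddCommGroup F] [InnerProductSpace ℂ F] [CompleteSpace F]

/-- The adjoint of a compact operator between Hilbert spaces is compact. -/
theorem isCompactOperator_adjoint {T : E →L[ℂ] F} (hT : IsCompactOperator T) :
    IsCompactOperator (ContinuousLinearMap.adjoint T) := by
  have hS : IsCompactOperator (T ∘L ContinuousLinearMap.adjoint T) :=
    hT.comp_clm (ContinuousLinearMap.adjoint T)
  have hS' := hS.isCompact_closure_image_closedBall 1
  refine (isCompactOperator_iff_isCompact_closure_image_closedBall (𝕜₁ := ℂ) (σ₁₂ := RingHom.id ℂ)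
    (ContinuousLinearMap.adjoint T).toLinearMap zero_lt_one).2 ?_
  have htb : TotallyBounded ((T ∘L ContinuousLinearMap.adjoint T) '' Metric.closedBall 0 1) :=
    hS'.totallyBounded.subset subset_closure
  refine TotallyBounded.isCompact_of_isClosed (TotallyBounded.closure ?_) isClosed_closure
  rw [Metric.totallyBounded_iff]
  intro ε hε
  obtain ⟨t, hts, htf, ht⟩ := (totallyBounded_iff_subset.1 htb) _
    (Metric.dist_mem_uniformity (show 0 < ε ^ 2 / 2 by positivity))
  have hts' : ∀ z ∈ t, ∃ y ∈ Metric.closedBall (0 : F) 1,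
      (T ∘L ContinuousLinearMap.adjoint T) y = z := fun z hz => hts hz
  choose! y hy hyt using hts'
  refine ⟨(fun z => ContinuousLinearMap.adjoint T (y z)) '' t, htf.image _, ?_⟩
  rintro _ ⟨x, hx, rfl⟩
  obtain ⟨z, hz, hxz⟩ := mem_iUnion₂.1 (ht ⟨x, hx, rfl⟩)
  rw [biUnion_image]
  refine mem_iUnion₂.2 ⟨z, hz, ?_⟩
  have hxz' : dist ((T ∘L ContinuousLinearMap.adjoint T) x) z < ε ^ 2 / 2 := hxz
  rw [← hyt z hz, dist_eq_norm, ← map_sub] at hxz'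
  have hd : ‖x - y z‖ ≤ 2 := by
    have h1 : ‖x‖ ≤ 1 := by simpa using hx
    have h2 : ‖y z‖ ≤ 1 := by simpa using hy z hz
    linarith [norm_sub_le x (y z)]
  have key : ‖ContinuousLinearMap.adjoint T (x - y z)‖ ^ 2
      ≤ ‖x - y z‖ * ‖(T ∘L ContinuousLinearMap.adjoint T) (x - y z)‖ := by
    rw [← inner_self_eq_norm_sq (𝕜 := ℂ), ContinuousLinearMap.adjoint_inner_left]
    exact re_inner_le_norm _ _
  change dist (ContinuousLinearMap.adjoint T x) (ContinuousLinearMap.adjoint T (y z)) < ε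
  rw [dist_eq_norm, ← map_sub]
  refine lt_of_pow_lt_pow_left₀ 2 hε.le ?_
  have := norm_nonneg ((T ∘L ContinuousLinearMap.adjoint T) (x - y z))
  nlinarith

end CompactAdjoint

section Module

variable {X : Type*} [MetricSpace X] {H : Type*} [NormedAddCommGroup H] [InnerProductSpace ℂ H]
  [CompleteSpace H] {ρ : C₀(X, ℂ) →⋆ₙₐ[ℂ] (H →L[ℂ] H)}

theorem hasCompactSupport_star {f : C₀(X, ℂ)} (hf : HasCompactSupport f) :
    HasCompactSupport (star f : C₀(X, ℂ)) :=
  hf.comp_left (g := star) (star_zero ℂ)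

theorem isCompactOperator_star {T : H →L[ℂ] H} (hT : IsCompactOperator T) :
    IsCompactOperator (star T : H →L[ℂ] H) :=
  isCompactOperator_adjoint hT

variable (ρ) in
/-- The locally compact operators form a norm closed `*`-algebra. -/
def locallyCompactOperators : NonUnitalStarSubalgebra ℂ (H →L[ℂ] H) where
  carrier := {T | IsLocallyCompact ρ T}
  add_mem' := fun {S T} hS hT f hf => by
    rw [mul_add, add_mul]
    exact ⟨(hS f hf).1.add (hT f hf).1, (hS f hf).2.add (hT f hf).2⟩
  zero_mem' := fun f _ => by
    rw [mul_zero, zero_mul]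
    exact ⟨isCompactOperator_zero, isCompactOperator_zero⟩
  mul_mem' := fun {S T} hS hT f hf => by
    rw [← mul_assoc, mul_assoc]
    exact ⟨(hS f hf).1.comp_clm T, (hT f hf).2.clm_comp S⟩
  smul_mem' := fun c T hT f hf => by
    rw [mul_smul_comm, smul_mul_assoc]
    exact ⟨(hT f hf).1.smul c, (hT f hf).2.smul c⟩
  star_mem' := fun {T} hT f hf => by
    have h := hT (star f) (hasCompactSupport_star hf)
    have h1 := isCompactOperator_star h.1
    have h2 := isCompactOperator_star h.2
    rw [star_mul, map_star, star_star] at h1 h2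
    exact ⟨h2, h1⟩

theorem isClosed_locallyCompactOperators :
    IsClosed (locallyCompactOperators ρ : Set (H →L[ℂ] H)) := by
  have h : (locallyCompactOperators ρ : Set (H →L[ℂ] H)) = ⋂ f : C₀(X, ℂ),
      ⋂ _ : HasCompactSupport f, ((fun T : H →L[ℂ] H => ρ f * T) ⁻¹' {S | IsCompactOperator S} ∩
        (fun T : H →L[ℂ] H => T * ρ f) ⁻¹' {S | IsCompactOperator S}) := by
    ext T
    simp only [mem_iInter, mem_inter_iff, mem_preimage]
    rfl
  rw [h]
  have hc : IsClosed {S : H →L[ℂ] H | IsCompactOperator S} :=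
    isClosed_setOfPred_isCompactOperator (σ₁₂ := RingHom.id ℂ)
  exact isClosed_iInter fun f => isClosed_iInter fun _ =>
    (hc.preimage (continuous_const_mul _)).inter (hc.preimage (continuous_mul_const _))

theorem isLocallyCompact_of_mem_roeAlgebra {T : H →L[ℂ] H} (hT : T ∈ roeAlgebra ρ) :
    IsLocallyCompact ρ T := by
  have h : roeAlgebra ρ ≤ locallyCompactOperators ρ :=
    NonUnitalStarSubalgebra.topologicalClosure_minimal _
      (NonUnitalStarAlgebra.adjoin_le fun T hT => hT.1) isClosed_locallyCompactOperators
  exact h hT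

theorem mem_roeAlgebra {T : H →L[ℂ] H} (h1 : IsLocallyCompact ρ T)
    (h2 : HasFinitePropagation ρ T) : T ∈ roeAlgebra ρ :=
  NonUnitalStarSubalgebra.le_topologicalClosure _
    (NonUnitalStarAlgebra.subset_adjoin ℂ _ ⟨h1, h2⟩)

theorem isClosed_roeAlgebra : IsClosed (roeAlgebra ρ : Set (H →L[ℂ] H)) :=
  NonUnitalStarSubalgebra.isClosed_topologicalClosure _

theorem roeAlgebra_le {S : NonUnitalStarSubalgebra ℂ (H →L[ℂ] H)}
    (hS : IsClosed (S : Set (H →L[ℂ] H)))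
    (h : ∀ T, IsLocallyCompact ρ T → HasFinitePropagation ρ T → T ∈ S) : roeAlgebra ρ ≤ S :=
  NonUnitalStarSubalgebra.topologicalClosure_minimal _
    (NonUnitalStarAlgebra.adjoin_le fun T hT => h T hT.1 hT.2) hS

theorem map_mul_map_eq_zero {f g : C₀(X, ℂ)} (h : ∀ x, f x ≠ 0 → g x = 0) : ρ f * ρ g = 0 := by
  rw [← map_mul]
  have : f * g = 0 := by
    ext x
    by_cases hx : f x = 0
    · simp [hx]
    · simp [h x hx]
  rw [this, map_zero]

theorem isCompactOperator_mul_left {E : Type*} [NormedAddCommGroup E] [NormedSpace ℂ E]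
    {S : E →L[ℂ] E} (hS : IsCompactOperator S) (T : E →L[ℂ] E) : IsCompactOperator (T * S) :=
  hS.clm_comp T

theorem isCompactOperator_mul_right {E : Type*} [NormedAddCommGroup E] [NormedSpace ℂ E]
    {S : E →L[ℂ] E} (hS : IsCompactOperator S) (T : E →L[ℂ] E) : IsCompactOperator (S * T) :=
  hS.comp_clm T

theorem isCompactOperator_rankOne {E F : Type*} [NormedAddCommGroup E] [InnerProductSpace ℂ E]
    [NormedAddCommGroup F] [InnerProductSpace ℂ F] (x : E) (y : F) :
    IsCompactOperator (InnerProductSpace.rankOne ℂ x y) := by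
  have h1 : IsCompactOperator (ContinuousLinearMap.toSpanSingleton ℂ x) :=
    isCompactOperator_of_locallyCompactSpace_rng (ContinuousLinearMap.toSpanSingleton ℂ x)
  exact h1.comp_clm (innerSL ℂ y)

/-- Rank one operators between compactly supported vectors lie in the Roe algebra. -/
theorem rankOne_mem_roeAlgebra_of_hasCompactSupport (x y : H) {f g : C₀(X, ℂ)}
    (hf : HasCompactSupport f) (hg : HasCompactSupport g) :
    InnerProductSpace.rankOne ℂ (ρ f x) (ρ g y) ∈ roeAlgebra ρ := by
  refine mem_roeAlgebra (fun k _ =>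
    ⟨isCompactOperator_mul_left (isCompactOperator_rankOne _ _) (ρ k),
      isCompactOperator_mul_right (isCompactOperator_rankOne _ _) (ρ k)⟩) ?_
  have hK : Bornology.IsBounded (tsupport f ∪ tsupport g) :=
    (IsCompact.union hf hg).isBounded
  refine ⟨Metric.diam (tsupport f ∪ tsupport g) + 1, by positivity, fun a b hab => ?_⟩
  have e : ρ a * InnerProductSpace.rankOne ℂ (ρ f x) (ρ g y) * ρ b
      = (ρ a * ρ f) * InnerProductSpace.rankOne ℂ x y * (ρ (star g) * ρ b) := by
    have e1 : InnerProductSpace.rankOne ℂ (ρ f x) (ρ g y)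
        = ρ f * InnerProductSpace.rankOne ℂ x y * ρ (star g) := by
      ext z
      change inner ℂ (ρ g y) z • ρ f x = ρ f (inner ℂ y (ρ (star g) z) • x)
      rw [map_smul, map_star, ContinuousLinearMap.star_eq_adjoint,
        ContinuousLinearMap.adjoint_inner_right]
    rw [e1]
    simp only [mul_assoc]
  rw [e]
  by_cases h1 : ∀ x, a x ≠ 0 → f x = 0
  · rw [map_mul_map_eq_zero h1, zero_mul, zero_mul]
  by_cases h2 : ∀ x, (star g) x ≠ 0 → b x = 0
  · rw [map_mul_map_eq_zero h2, mul_zero]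
  push Not at h1 h2
  obtain ⟨x₁, hx₁, hx₂⟩ := h1
  obtain ⟨x₂, hx₃, hx₄⟩ := h2
  have hx₃' : g x₂ ≠ 0 := fun h => hx₃ (by simp [h])
  have := hab x₁ (subset_tsupport _ hx₁) x₂ (subset_tsupport _ hx₄)
  have := Metric.dist_le_diam_of_mem hK (Or.inl (subset_tsupport _ hx₂))
    (Or.inr (subset_tsupport _ hx₃'))
  linarith

theorem zeroAtInfty_sum_apply {ι : Type*} (s : Finset ι) (F : ι → C₀(X, ℂ)) (x : X) :
    (∑ i ∈ s, F i) x = ∑ i ∈ s, F i x := by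
  classical
  induction s using Finset.induction_on with
  | empty => rfl
  | insert i s hi ih =>
    rw [Finset.sum_insert hi, Finset.sum_insert hi, ZeroAtInftyContinuousMap.add_apply, ih]

/-- A locally finite family of compactly supported real functions whose squares add up to `1`. -/
structure IsSquarePartition {ι : Type*} (g : ι → C₀(X, ℂ)) : Prop where
  isSelfAdjoint : ∀ i, star (g i) = g i
  hasCompactSupport : ∀ i, HasCompactSupport (g i)
  finite : ∀ K : Set X, IsCompact K → {i | ∃ x ∈ K, g i x ≠ 0}.Finite
  hasSum : ∀ x, HasSum (fun i => g i x * g i x) 1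

namespace IsSquarePartition

variable {ι : Type*} {g : ι → C₀(X, ℂ)} (hg : IsSquarePartition g)
include hg

theorem exists_sum_eq (s : Finset ι) (x : X) :
    ∃ r : ℝ, 0 ≤ r ∧ r ≤ 1 ∧ (∑ i ∈ s, g i * g i) x = (r : ℂ) := by
  have h : ∀ i, ((g i x).re : ℂ) = g i x := fun i =>
    Complex.conj_eq_iff_re.1 (by
      have := DFunLike.congr_fun (hg.isSelfAdjoint i) x
      rwa [ZeroAtInftyContinuousMap.star_apply] at this)
  have hs : HasSum (fun i => (g i x).re * (g i x).re) 1 := by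
    rw [← Complex.hasSum_ofReal]
    simpa [h] using hg.hasSum x
  refine ⟨∑ i ∈ s, (g i x).re * (g i x).re, Finset.sum_nonneg fun i _ => mul_self_nonneg _,
    sum_le_hasSum s (fun i _ => mul_self_nonneg _) hs, ?_⟩
  have e : (∑ i ∈ s, g i * g i) x = ∑ i ∈ s, g i x * g i x := by
    exact zeroAtInfty_sum_apply s _ x
  rw [e]
  push_cast
  exact Finset.sum_congr rfl fun i _ => by rw [h]

theorem norm_sum_le (s : Finset ι) : ‖∑ i ∈ s, g i * g i‖ ≤ 1 := by
  rw [← ZeroAtInftyContinuousMap.norm_toBCF_eq_norm,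
    BoundedContinuousFunction.norm_le zero_le_one]
  intro x
  obtain ⟨r, h0, h1, h⟩ := hg.exists_sum_eq s x
  change ‖(∑ i ∈ s, g i * g i) x‖ ≤ 1
  rw [h, Complex.norm_real, Real.norm_of_nonneg h0]
  exact h1

theorem hasCompactSupport_sum (s : Finset ι) :
    HasCompactSupport (∑ i ∈ s, g i * g i : C₀(X, ℂ)) := by
  classical
  induction s using Finset.induction_on with
  | empty => exact HasCompactSupport.zero
  | insert i s hi ih =>
    rw [Finset.sum_insert hi]
    exact ((hg.hasCompactSupport i).mul_left (f := g i)).add ih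

theorem tendsto_sum_mul (f : C₀(X, ℂ)) :
    Filter.Tendsto (fun s : Finset ι => (∑ i ∈ s, g i * g i) * f) Filter.atTop (𝓝 f) := by
  classical
  rw [Metric.tendsto_atTop]
  intro ε hε
  obtain ⟨K, hK, hKf⟩ := Filter.mem_cocompact.1
    (f.zero_at_infty' (Metric.ball_mem_nhds 0 (half_pos hε)))
  refine ⟨(hg.finite K hK).toFinset, fun s hs => ?_⟩
  rw [dist_eq_norm, ← ZeroAtInftyContinuousMap.norm_toBCF_eq_norm]
  refine lt_of_le_of_lt ?_ (half_lt_self hε)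
  rw [BoundedContinuousFunction.norm_le (half_pos hε).le]
  intro x
  change ‖((∑ i ∈ s, g i * g i) * f) x - f x‖ ≤ _
  obtain ⟨r, h0, h1, h⟩ := hg.exists_sum_eq s x
  rw [ZeroAtInftyContinuousMap.mul_apply, h, ← sub_one_mul, norm_mul]
  by_cases hx : x ∈ K
  · have h2 : HasSum (fun i => g i x * g i x) (∑ i ∈ s, g i x * g i x) := by
      refine hasSum_sum_of_ne_finset_zero fun i hi => ?_
      by_contra hne
      exact hi (hs ((hg.finite K hK).mem_toFinset.2 ⟨x, hx, fun h => hne (by simp [h])⟩))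
    have h3 : (r : ℂ) = 1 := by
      rw [← h, ← h2.unique (hg.hasSum x)]
      exact zeroAtInfty_sum_apply s _ x
    rw [h3, sub_self, norm_zero, zero_mul]
    positivity
  · have h2 : ‖f x‖ < ε / 2 := by simpa using hKf hx
    have h3 : ‖(r : ℂ) - 1‖ ≤ 1 := by
      rw [← Complex.ofReal_one, ← Complex.ofReal_sub, Complex.norm_real, Real.norm_eq_abs,
        abs_le]
      constructor <;> linarith
    calc ‖(r : ℂ) - 1‖ * ‖f x‖ ≤ 1 * (ε / 2) := by gcongr
      _ = ε / 2 := one_mul _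

/-- In a nondegenerate representation, a square partition of unity sums strongly to `1`. -/
theorem tendsto_map_sum_apply
    (hρ : Dense (Submodule.span ℂ {v : H | ∃ f h, ρ f h = v} : Set H)) (h : H) :
    Filter.Tendsto (fun s : Finset ι => ρ (∑ i ∈ s, g i * g i) h) Filter.atTop (𝓝 h) := by
  classical
  have hle : ∀ s : Finset ι, ∀ k : H, ‖ρ (∑ i ∈ s, g i * g i) k‖ ≤ ‖k‖ := fun s k => by
    refine ((ρ (∑ i ∈ s, g i * g i)).le_opNorm k).trans ?_
    have := (NonUnitalStarAlgHom.norm_apply_le ρ (∑ i ∈ s, g i * g i)).trans (hg.norm_sum_le s)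
    exact mul_le_of_le_one_left (norm_nonneg _) this
  have hspan : ∀ k ∈ Submodule.span ℂ {v : H | ∃ f h, ρ f h = v},
      Filter.Tendsto (fun s : Finset ι => ρ (∑ i ∈ s, g i * g i) k) Filter.atTop (𝓝 k) := by
    intro k hk
    induction hk using Submodule.span_induction with
    | mem v hv =>
      obtain ⟨f, k, rfl⟩ := hv
      have hc : Continuous fun f' : C₀(X, ℂ) => ρ f' k := by
        have : Continuous ρ := AddMonoidHomClass.continuous_of_bound ρ 1 fun f => by
          simpa using NonUnitalStarAlgHom.norm_apply_le ρ f
        exact this.clm_apply continuous_const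
      have := (hc.tendsto f).comp (hg.tendsto_sum_mul f)
      refine this.congr fun s => ?_
      change ρ ((∑ i ∈ s, g i * g i) * f) k = _
      rw [map_mul]
      rfl
    | zero => simp
    | add x y _ _ hx hy => simpa only [map_add] using hx.add hy
    | smul c x _ hx => simpa only [map_smul] using hx.const_smul c
  rw [Metric.tendsto_atTop]
  intro ε hε
  obtain ⟨k, hk, hhk⟩ := Metric.dense_iff.1 hρ h (ε / 3) (by positivity)
  obtain ⟨s₀, hs₀⟩ := Metric.tendsto_atTop.1 (hspan _ hhk) (ε / 3) (by positivity)
  refine ⟨s₀, fun s hs => ?_⟩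
  have h1 := hs₀ s hs
  rw [Metric.mem_ball] at hk
  have h2 : dist (ρ (∑ i ∈ s, g i * g i) h) (ρ (∑ i ∈ s, g i * g i) k) < ε / 3 := by
    rw [dist_eq_norm, ← map_sub]
    refine (hle s _).trans_lt ?_
    rwa [← dist_eq_norm, dist_comm]
  have h3 := dist_triangle (ρ (∑ i ∈ s, g i * g i) h) (ρ (∑ i ∈ s, g i * g i) k) h
  have h4 := dist_triangle (ρ (∑ i ∈ s, g i * g i) k) k h
  linarith

theorem hasSum_norm_sq
    (hρ : Dense (Submodule.span ℂ {v : H | ∃ f h, ρ f h = v} : Set H)) (h : H) :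
    HasSum (fun i => ‖ρ (g i) h‖ ^ 2) (‖h‖ ^ 2) := by
  have h1 := (RCLike.continuous_re (K := ℂ)).continuousAt.tendsto.comp
    ((hg.tendsto_map_sum_apply hρ h).inner (𝕜 := ℂ) (tendsto_const_nhds (x := h)))
  rw [inner_self_eq_norm_sq] at h1
  refine h1.congr fun s => ?_
  have e : ρ (∑ i ∈ s, g i * g i) h = ∑ i ∈ s, ρ (g i) (ρ (g i) h) := by
    rw [map_sum, _root_.sum_apply]
    exact Finset.sum_congr rfl fun i _ => by rw [map_mul]; rfl
  change RCLike.re (inner ℂ (ρ (∑ i ∈ s, g i * g i) h) h) = _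
  rw [e, sum_inner, map_sum]
  refine Finset.sum_congr rfl fun i _ => ?_
  have e2 : ρ (g i) = ContinuousLinearMap.adjoint (ρ (g i)) := by
    rw [← ContinuousLinearMap.star_eq_adjoint, ← map_star, hg.isSelfAdjoint]
  nth_rewrite 1 [e2]
  rw [ContinuousLinearMap.adjoint_inner_left, inner_self_eq_norm_sq]

/-- The Roe algebra of a nondegenerate module contains all rank one operators. -/
theorem rankOne_mem_roeAlgebra
    (hρ : Dense (Submodule.span ℂ {v : H | ∃ f h, ρ f h = v} : Set H)) (x y : H) :
    InnerProductSpace.rankOne ℂ x y ∈ roeAlgebra ρ := by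
  have key : ∀ (s : Finset ι) (u v : H),
      InnerProductSpace.rankOne ℂ u (ρ (∑ i ∈ s, g i * g i) v) ∈ roeAlgebra ρ := by
    intro s u v
    have h3 := ((InnerProductSpace.rankOne ℂ (ρ (∑ i ∈ s, g i * g i) v)).continuous.tendsto u).comp
      (hg.tendsto_map_sum_apply hρ u)
    have h4 : InnerProductSpace.rankOne ℂ (ρ (∑ i ∈ s, g i * g i) v) u ∈ roeAlgebra ρ :=
      isClosed_roeAlgebra.mem_of_tendsto h3 (Filter.Eventually.of_forall fun t =>
        rankOne_mem_roeAlgebra_of_hasCompactSupport _ _ (hg.hasCompactSupport_sum s)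
          (hg.hasCompactSupport_sum t))
    have h5 := star_mem h4
    rwa [ContinuousLinearMap.star_eq_adjoint, InnerProductSpace.adjoint_rankOne] at h5
  have h3 := ((InnerProductSpace.rankOne ℂ x).continuous.tendsto y).comp
    (hg.tendsto_map_sum_apply hρ y)
  exact isClosed_roeAlgebra.mem_of_tendsto h3 (Filter.Eventually.of_forall fun t => key t x y)

end IsSquarePartition

end Module

end Coarse

namespace Coarse

section PartialIsometry

variable {G : Type*} {H K L : Type*} [NormedAddCommGroup H] [InnerProductSpace ℂ H]
  [CompleteSpace H] [NormedAddCommGroup K] [InnerProductSpace ℂ K] [CompleteSpace K]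
  [NormedAddCommGroup L] [InnerProductSpace ℂ L] [CompleteSpace L]

/-- The isometry `ℓ²(G) → H` sending the standard basis to an orthonormal family. -/
def orthonormalIsometry {a : G → H} (ha : Orthonormal ℂ a) : lp (fun _ : G => ℂ) 2 →L[ℂ] H :=
  ha.orthogonalFamily.linearIsometry.toContinuousLinearMap

/-- The partial isometry `∑ |a γ⟩⟨b γ|` between the closed spans of two orthonormal families. -/
def partialIsometry {a : G → H} {b : G → K} (ha : Orthonormal ℂ a) (hb : Orthonormal ℂ b) :
    K →L[ℂ] H :=
  orthonormalIsometry ha ∘L ContinuousLinearMap.adjoint (orthonormalIsometry hb)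

variable {a : G → H} {b : G → K} {c : G → L} (ha : Orthonormal ℂ a) (hb : Orthonormal ℂ b)
  (hc : Orthonormal ℂ c)

theorem adjoint_orthonormalIsometry_apply (x : H) (γ : G) :
    ContinuousLinearMap.adjoint (orthonormalIsometry ha) x γ = inner ℂ (a γ) x := by
  classical
  have h1 := lp.inner_single_left (𝕜 := ℂ) (G := fun _ : G => ℂ) γ 1
    (ContinuousLinearMap.adjoint (orthonormalIsometry ha) x)
  rw [ContinuousLinearMap.adjoint_inner_right] at h1
  have h2 : orthonormalIsometry ha (lp.single 2 γ 1) = a γ := by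
    refine (ha.orthogonalFamily.linearIsometry_apply_single (i := γ) (1 : ℂ)).trans ?_
    simp
  rw [h2] at h1
  simpa using h1.symm

theorem hasSum_partialIsometry (x : K) :
    HasSum (fun γ => inner ℂ (b γ) x • a γ) (partialIsometry ha hb x) := by
  have h := ha.orthogonalFamily.hasSum_linearIsometry
    (ContinuousLinearMap.adjoint (orthonormalIsometry hb) x)
  have e : (fun γ => inner ℂ (b γ) x • a γ) = fun γ => LinearIsometry.toSpanSingleton ℂ H (ha.1 γ)
      (ContinuousLinearMap.adjoint (orthonormalIsometry hb) x γ) := by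
    ext γ
    rw [LinearIsometry.toSpanSingleton_apply, adjoint_orthonormalIsometry_apply]
  rw [e]
  exact h

theorem adjoint_partialIsometry :
    ContinuousLinearMap.adjoint (partialIsometry ha hb) = partialIsometry hb ha := by
  rw [partialIsometry, ContinuousLinearMap.adjoint_comp, ContinuousLinearMap.adjoint_adjoint]
  rfl

theorem adjoint_comp_orthonormalIsometry :
    ContinuousLinearMap.adjoint (orthonormalIsometry ha) ∘L orthonormalIsometry ha = 1 :=
  (ContinuousLinearMap.norm_map_iff_adjoint_comp_self _).1
    ha.orthogonalFamily.linearIsometry.norm_map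

theorem partialIsometry_comp :
    partialIsometry ha hb ∘L partialIsometry hb hc = partialIsometry ha hc := by
  have h := adjoint_comp_orthonormalIsometry hb
  rw [partialIsometry, partialIsometry, ContinuousLinearMap.comp_assoc,
    ← ContinuousLinearMap.comp_assoc _ (orthonormalIsometry hb), h]
  rfl

theorem isStarProjection_partialIsometry : IsStarProjection (partialIsometry ha ha) :=
  ⟨partialIsometry_comp ha ha ha, adjoint_partialIsometry ha ha⟩

theorem partialIsometry_apply_self (γ : G) : partialIsometry ha hb (b γ) = a γ := by
  classical
  refine (hasSum_partialIsometry ha hb (b γ)).unique ?_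
  convert hasSum_ite_eq γ (a γ) using 2 with γ'
  rw [orthonormal_iff_ite.1 hb]
  split_ifs with h
  · rw [h, one_smul]
  · rw [zero_smul]

theorem isometry_comp_partialIsometry (W : H →ₗᵢ[ℂ] L) :
    W.toContinuousLinearMap ∘L partialIsometry ha hb
      = partialIsometry (ha.comp_linearIsometry W) hb := by
  ext x
  have h := (hasSum_partialIsometry ha hb x).mapL W.toContinuousLinearMap
  refine h.unique ?_
  convert hasSum_partialIsometry (ha.comp_linearIsometry W) hb x using 2 with γ
  rw [map_smul]
  rfl

theorem comp_partialIsometry_comp_eq_zero {E F : Type*} [NormedAddCommGroup E]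
    [InnerProductSpace ℂ E] [CompleteSpace E] [NormedAddCommGroup F] [NormedSpace ℂ F]
    (A : H →L[ℂ] F) (B : E →L[ℂ] K)
    (h : ∀ γ, A (a γ) = 0 ∨ ContinuousLinearMap.adjoint B (b γ) = 0) :
    A ∘L partialIsometry ha hb ∘L B = 0 := by
  ext x
  have h1 := (hasSum_partialIsometry ha hb (B x)).mapL A
  refine h1.unique ?_
  rw [_root_.zero_apply]
  convert hasSum_zero using 2 with γ
  rw [map_smul]
  rcases h γ with h | h
  · rw [h, smul_zero]
  · rw [← ContinuousLinearMap.adjoint_inner_left, h, inner_zero_left, zero_smul]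

theorem comp_partialIsometry_eq_sum {F : Type*} [NormedAddCommGroup F] [InnerProductSpace ℂ F]
    (A : H →L[ℂ] F) (s : Finset G) (h : ∀ γ ∉ s, A (a γ) = 0) :
    A ∘L partialIsometry ha hb = ∑ γ ∈ s, InnerProductSpace.rankOne ℂ (A (a γ)) (b γ) := by
  ext x
  have h1 := (hasSum_partialIsometry ha hb x).mapL A
  refine h1.unique ?_
  rw [_root_.sum_apply]
  have h2 : HasSum (fun γ => A (inner ℂ (b γ) x • a γ)) (∑ γ ∈ s, A (inner ℂ (b γ) x • a γ)) :=
    hasSum_sum_of_ne_finset_zero fun γ hγ => by rw [map_smul, h γ hγ, smul_zero]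
  convert h2 using 1
  exact Finset.sum_congr rfl fun γ _ => by simp

end PartialIsometry

end Coarse

namespace Coarse

section SumIsometry

variable {X : Type*} [MetricSpace X] {H : Type*} [NormedAddCommGroup H] [InnerProductSpace ℂ H]
  [CompleteSpace H] {ρ : C₀(X, ℂ) →⋆ₙₐ[ℂ] (H →L[ℂ] H)} {K : Type*} [NormedAddCommGroup K]
  [InnerProductSpace ℂ K] [CompleteSpace K] {ι : Type*} {g : ι → C₀(X, ℂ)}
  {V : ι → H →ₗᵢ[ℂ] K}

/-- Given isometries `V i : H → K` with orthogonal ranges and a square partition of unity `g`, the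
operator `∑ V i (g i)` is an isometry. -/
theorem exists_sumIsometry (hg : IsSquarePartition g)
    (hρ : Dense (Submodule.span ℂ {v : H | ∃ f h, ρ f h = v} : Set H))
    (hV : OrthogonalFamily ℂ (fun _ : ι => H) V) :
    ∃ W : H →ₗᵢ[ℂ] K, ∀ h, HasSum (fun i => V i (ρ (g i) h)) (W h) := by
  have hmem : ∀ h : H, Memℓp (fun i => ρ (g i) h) 2 := fun h => by
    refine memℓp_gen ?_
    simpa using (hg.hasSum_norm_sq hρ h).summable
  have hnorm : ∀ h : H, ‖(⟨fun i => ρ (g i) h, hmem h⟩ : lp (fun _ : ι => H) 2)‖ = ‖h‖ := by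
    intro h
    have h1 := lp.hasSum_norm (p := 2) (by simp)
      (⟨fun i => ρ (g i) h, hmem h⟩ : lp (fun _ : ι => H) 2)
    simp only [ENNReal.toReal_ofNat, Real.rpow_ofNat] at h1
    exact (pow_left_inj₀ (norm_nonneg _) (norm_nonneg _) two_ne_zero).1
      (h1.unique (hg.hasSum_norm_sq hρ h))
  let D : H →ₗᵢ[ℂ] lp (fun _ : ι => H) 2 :=
    { toFun := fun h => ⟨fun i => ρ (g i) h, hmem h⟩
      map_add' := fun x y => Subtype.ext (funext fun i => map_add (ρ (g i)) x y)
      map_smul' := fun c x => Subtype.ext (funext fun i => map_smul (ρ (g i)) c x)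
      norm_map' := hnorm }
  exact ⟨hV.linearIsometry.comp D, fun h => hV.hasSum_linearIsometry (D h)⟩

end SumIsometry

section Transport

variable {X : Type*} [MetricSpace X] {Y : Set X}

/-- Restriction of functions to a closed subset. -/
def restrictZeroAtInfty (hY : IsClosed Y) (f : C₀(X, ℂ)) : C₀(Y, ℂ) :=
  f.comp ⟨⟨Subtype.val, continuous_subtype_val⟩,
    hY.isClosedEmbedding_subtypeVal.tendsto_cocompact⟩

theorem IsSquarePartition.restrict {ι : Type*} {g : ι → C₀(X, ℂ)} (hg : IsSquarePartition g)
    (hY : IsClosed Y) : IsSquarePartition fun i => restrictZeroAtInfty hY (g i) where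
  isSelfAdjoint i := ZeroAtInftyContinuousMap.ext fun y =>
    DFunLike.congr_fun (hg.isSelfAdjoint i) (y : X)
  hasCompactSupport i :=
    (hg.hasCompactSupport i).comp_isClosedEmbedding hY.isClosedEmbedding_subtypeVal
  finite _ hK := (hg.finite _ (hK.image continuous_subtype_val)).subset
    fun _ ⟨y, hy, hi⟩ => ⟨y, mem_image_of_mem _ hy, hi⟩
  hasSum y := hg.hasSum y

variable {H : Type*} [NormedAddCommGroup H] [InnerProductSpace ℂ H] [CompleteSpace H]
  {ρ : C₀(Y, ℂ) →⋆ₙₐ[ℂ] (H →L[ℂ] H)} {K : Type*} [NormedAddCommGroup K]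
  [InnerProductSpace ℂ K] [CompleteSpace K] {σ : C₀(X, ℂ) →⋆ₙₐ[ℂ] (K →L[ℂ] K)}
  {ι : Type*} {g : ι → C₀(X, ℂ)} {V : ι → H →ₗᵢ[ℂ] K} {W : H →ₗᵢ[ℂ] K} {hY : IsClosed Y}

/-- `W = ∑ V i (g i)` is a covering isometry for the inclusion of the closed set `Y`, built from a
square partition of unity `g` by sets of uniformly bounded diameter. -/
structure IsCovering (ρ : C₀(Y, ℂ) →⋆ₙₐ[ℂ] (H →L[ℂ] H)) (σ : C₀(X, ℂ) →⋆ₙₐ[ℂ] (K →L[ℂ] K))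
    (hY : IsClosed Y) (g : ι → C₀(X, ℂ)) (V : ι → H →ₗᵢ[ℂ] K) (W : H →ₗᵢ[ℂ] K) (D : ℝ) :
    Prop where
  isSquarePartition : IsSquarePartition g
  hasSum : ∀ h, HasSum (fun i => V i (ρ (restrictZeroAtInfty hY (g i)) h)) (W h)
  map_eq_zero : ∀ i f, (∀ x, g i x ≠ 0 → f x = 0) → ∀ h, σ f (V i h) = 0
  dist_le : ∀ i x y, g i x ≠ 0 → g i y ≠ 0 → dist x y ≤ D

namespace IsCovering

variable {D : ℝ} (hW : IsCovering ρ σ hY g V W D)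
include hW

theorem map_comp_eq_zero (f : C₀(X, ℂ)) (h : H)
    (hf : ∀ i x, g i x ≠ 0 → f x ≠ 0 → ρ (restrictZeroAtInfty hY (g i)) h = 0) :
    σ f (W h) = 0 := by
  refine ((hW.hasSum h).mapL (σ f)).unique ?_
  convert hasSum_zero using 2 with i
  by_cases hi : ∀ x, g i x ≠ 0 → f x = 0
  · exact hW.map_eq_zero i f hi _
  · push Not at hi
    obtain ⟨x, h1, h2⟩ := hi
    rw [hf i x h1 h2, map_zero, map_zero]

theorem map_comp_eq_sum (f : C₀(X, ℂ)) (hf : HasCompactSupport f) :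
    σ f ∘L W.toContinuousLinearMap = ∑ i ∈ (hW.isSquarePartition.finite _ hf).toFinset,
      σ f ∘L (V i).toContinuousLinearMap ∘L ρ (restrictZeroAtInfty hY (g i)) := by
  ext h
  refine ((hW.hasSum h).mapL (σ f)).unique ?_
  rw [_root_.sum_apply]
  refine hasSum_sum_of_ne_finset_zero fun i hi => hW.map_eq_zero i f (fun x hx => ?_) _
  by_contra hfx
  exact hi ((Finite.mem_toFinset _).2 ⟨x, subset_tsupport _ hfx, hx⟩)

theorem isCompactOperator_map_comp (f : C₀(X, ℂ)) (hf : HasCompactSupport f) {T : H →L[ℂ] H}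
    (hT : IsLocallyCompact ρ T) : IsCompactOperator (σ f ∘L W.toContinuousLinearMap ∘L T) := by
  rw [← ContinuousLinearMap.comp_assoc, hW.map_comp_eq_sum f hf]
  have e : (∑ i ∈ (hW.isSquarePartition.finite _ hf).toFinset, σ f ∘L
      (V i).toContinuousLinearMap ∘L ρ (restrictZeroAtInfty hY (g i))) ∘L T
      = ∑ i ∈ (hW.isSquarePartition.finite _ hf).toFinset, (σ f ∘L
        (V i).toContinuousLinearMap) ∘L (ρ (restrictZeroAtInfty hY (g i)) * T) := by
    ext x
    simp
  rw [e]
  refine Submodule.sum_mem (compactOperator (RingHom.id ℂ) H K) (fun i _ => ?_)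
  have h1 := (hT _ ((hW.isSquarePartition.restrict hY).hasCompactSupport i)).1
  exact h1.clm_comp (σ f ∘L (V i).toContinuousLinearMap)

end IsCovering

/-- Conjugation by an isometry. -/
def conjIsometry (W : H →ₗᵢ[ℂ] K) : (H →L[ℂ] H) →⋆ₙₐ[ℂ] (K →L[ℂ] K) where
  toFun T := W.toContinuousLinearMap ∘L T ∘L ContinuousLinearMap.adjoint W.toContinuousLinearMap
  map_smul' c T := by ext x; simp
  map_zero' := by ext x; simp
  map_add' S T := by ext x; simp
  map_mul' S T := by
    have h : ContinuousLinearMap.adjoint W.toContinuousLinearMap ∘L W.toContinuousLinearMap = 1 :=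
      (ContinuousLinearMap.norm_map_iff_adjoint_comp_self _).1 W.norm_map
    ext x
    have hx := DFunLike.congr_fun h
      (T (ContinuousLinearMap.adjoint W.toContinuousLinearMap x))
    exact congrArg (fun z => W (S z)) hx.symm
  map_star' T := by
    simp only [ContinuousLinearMap.star_eq_adjoint, ContinuousLinearMap.adjoint_comp,
      ContinuousLinearMap.adjoint_adjoint, ContinuousLinearMap.comp_assoc]

theorem conjIsometry_apply (W : H →ₗᵢ[ℂ] K) (T : H →L[ℂ] H) : conjIsometry W T =
    W.toContinuousLinearMap ∘L T ∘L ContinuousLinearMap.adjoint W.toContinuousLinearMap := rfl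

namespace IsCovering

variable {D : ℝ} (hW : IsCovering ρ σ hY g V W D)
include hW

theorem isLocallyCompact_conj {T : H →L[ℂ] H} (hT : IsLocallyCompact ρ T) :
    IsLocallyCompact σ (conjIsometry W T) := by
  have key : ∀ S : H →L[ℂ] H, IsLocallyCompact ρ S → ∀ f : C₀(X, ℂ), HasCompactSupport f →
      IsCompactOperator (σ f * conjIsometry W S) := fun S hS f hf =>
    (hW.isCompactOperator_map_comp f hf hS).comp_clm
      (ContinuousLinearMap.adjoint W.toContinuousLinearMap)
  refine fun f hf => ⟨key T hT f hf, ?_⟩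
  have h := isCompactOperator_star (key (star T) ((locallyCompactOperators ρ).star_mem' hT)
    (star f) (hasCompactSupport_star hf))
  rwa [star_mul, ← map_star, ← map_star, star_star, star_star] at h

theorem hasFinitePropagation_conj {T : H →L[ℂ] H} (hT : HasFinitePropagation ρ T) :
    HasFinitePropagation σ (conjIsometry W T) := by
  obtain ⟨R, hR, hRT⟩ := hT
  refine ⟨R + 2 * |D|, by positivity, fun f k hfk => ?_⟩
  have hts : ∀ i x, g i x ≠ 0 → ∀ y ∈ tsupport (restrictZeroAtInfty hY (g i)),
      dist x (y : X) ≤ D := fun i x hx y hy =>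
    closure_minimal (t := {y : Y | dist x (y : X) ≤ D})
      (fun y hy => hW.dist_le i x y hx hy) (isClosed_le (by fun_prop) continuous_const) hy
  have hzero : ∀ i x, g i x ≠ 0 → f x ≠ 0 → ∀ j x', g j x' ≠ 0 → k x' ≠ 0 →
      ρ (restrictZeroAtInfty hY (g i)) * T * ρ (restrictZeroAtInfty hY (g j)) = 0 := by
    intro i x hi hfx j x' hj hkx
    refine hRT _ _ fun y hy y' hy' => ?_
    have h1 := hts i x hi y hy
    have h2 := hts j x' hj y' hy'
    have h3 := hfk x (subset_tsupport _ hfx) x' (subset_tsupport _ hkx)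
    have h4 := dist_triangle4 x (y : X) (y' : X) x'
    rw [dist_comm] at h2
    have h5 := le_abs_self D
    rw [Subtype.dist_eq]
    linarith
  have hsa : ∀ i, star (ρ (restrictZeroAtInfty hY (g i))) = ρ (restrictZeroAtInfty hY (g i)) :=
    fun i => by rw [← map_star, (hW.isSquarePartition.restrict hY).isSelfAdjoint]
  have hleft : ∀ i x, g i x ≠ 0 → f x ≠ 0 → ρ (restrictZeroAtInfty hY (g i)) ∘L T ∘L
      ContinuousLinearMap.adjoint W.toContinuousLinearMap ∘L σ k = 0 := by
    intro i x hi hfx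
    have h1 : σ (star k) ∘L W.toContinuousLinearMap ∘L star T ∘L
        ρ (restrictZeroAtInfty hY (g i)) = 0 := by
      ext z
      refine hW.map_comp_eq_zero (star k) _ fun j x' hj hkx => ?_
      have h2 := congrArg star (hzero i x hi hfx j x' hj (fun h => hkx (by simp [h])))
      rw [star_mul, star_mul, hsa, hsa, star_zero] at h2
      exact DFunLike.congr_fun h2 z
    have h2 := congrArg ContinuousLinearMap.adjoint h1
    rw [map_zero] at h2
    rw [← h2]
    simp only [ContinuousLinearMap.adjoint_comp, map_star, ContinuousLinearMap.star_eq_adjoint,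
      ContinuousLinearMap.adjoint_adjoint, ContinuousLinearMap.comp_assoc]
    rw [← ContinuousLinearMap.star_eq_adjoint (ρ _), hsa]
  ext z
  refine hW.map_comp_eq_zero f _ fun i x hi hfx => ?_
  exact DFunLike.congr_fun (hleft i x hi hfx) z

theorem conj_mem_roeAlgebra {T : H →L[ℂ] H} (hT : T ∈ roeAlgebra ρ) :
    conjIsometry W T ∈ roeAlgebra σ := by
  have hc : Continuous (conjIsometry W) := by
    have h1 : Continuous fun T : H →L[ℂ] H => T ∘L
      ContinuousLinearMap.adjoint W.toContinuousLinearMap := by fun_prop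
    have h2 : Continuous fun T : K →L[ℂ] H => W.toContinuousLinearMap ∘L T := by fun_prop
    exact h2.comp h1
  have h : roeAlgebra ρ ≤ (roeAlgebra σ).comap (conjIsometry W) :=
    roeAlgebra_le (isClosed_roeAlgebra.preimage hc) fun T h1 h2 =>
      mem_roeAlgebra (hW.isLocallyCompact_conj h1) (hW.hasFinitePropagation_conj h2)
  exact h hT

/-- The `*`-homomorphism of Roe algebras induced by a covering isometry. -/
def conjHom : roeAlgebra ρ →⋆ₙₐ[ℂ] roeAlgebra σ :=
  NonUnitalStarAlgHom.codRestrict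
    ((conjIsometry W).comp (NonUnitalStarSubalgebraClass.subtype (roeAlgebra ρ))) _
    fun T => hW.conj_mem_roeAlgebra T.2

end IsCovering

end Transport

end Coarse

namespace Coarse

section LocalizedFamily

variable {Y : Type*} [MetricSpace Y] {H : Type*} [NormedAddCommGroup H]
  [InnerProductSpace ℂ H] [CompleteSpace H] {ρ : C₀(Y, ℂ) →⋆ₙₐ[ℂ] (H →L[ℂ] H)}

theorem exists_zeroAtInfty_ne_zero_of_ball [LocallyCompactSpace Y] (y : Y) {r : ℝ} (hr : 0 < r) :
    ∃ f : C₀(Y, ℂ), f y ≠ 0 ∧ ∀ z, f z ≠ 0 → dist z y < r := by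
  obtain ⟨φ, h1, h2, h3, -⟩ := exists_continuous_one_zero_of_isCompact
    (isCompact_singleton (x := y)) (Metric.isOpen_ball (x := y) (ε := r)).isClosed_compl
    (by simpa using hr)
  have hc : HasCompactSupport fun z => (φ z : ℂ) := h3.comp_left (g := fun t : ℝ => (t : ℂ)) rfl
  refine ⟨⟨⟨fun z => (φ z : ℂ), by fun_prop⟩, hc.is_zero_at_infty⟩, ?_, fun z hz => ?_⟩
  · change ((φ y : ℝ) : ℂ) ≠ 0
    rw [h1 (mem_singleton y)]
    simp
  · by_contra hd
    refine hz ?_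
    change ((φ z : ℝ) : ℂ) = 0
    rw [h2 (by simpa using hd)]
    simp

/-- In an ample module, a uniformly separated family of points carries an orthonormal family of
vectors localized near these points. -/
theorem IsAmple.exists_orthonormal [LocallyCompactSpace Y] (hρ : IsAmple ρ) {G : Type*}
    (c : G → Y) {r : ℝ} (hr : 0 < r)
    (hc : ∀ γ γ', γ ≠ γ' → r ≤ dist (c γ) (c γ')) :
    ∃ e : G → H, Orthonormal ℂ e ∧
      ∀ γ (f : C₀(Y, ℂ)), ρ f (e γ) ≠ 0 → ∃ z, f z ≠ 0 ∧ dist z (c γ) < r / 4 := by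
  choose φ hφ1 hφ2 using fun γ => exists_zeroAtInfty_ne_zero_of_ball (c γ)
    (show 0 < r / 4 by positivity)
  have h1 : ∀ γ, ∃ h, ‖ρ (φ γ) h‖ = 1 := by
    intro γ
    have hne : ρ (φ γ) ≠ 0 := fun h0 => by
      refine hρ.not_compact (φ γ) (fun h => hφ1 γ (by rw [h]; rfl)) ?_
      rw [h0]
      exact isCompactOperator_zero
    obtain ⟨h, hh⟩ : ∃ h, ρ (φ γ) h ≠ 0 := by
      by_contra! hall
      exact hne (ContinuousLinearMap.ext hall)
    refine ⟨((‖ρ (φ γ) h‖⁻¹ : ℝ) : ℂ) • h, ?_⟩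
    rw [map_smul, norm_smul, Complex.norm_real, norm_inv, norm_norm,
      inv_mul_cancel₀ (norm_ne_zero_iff.2 hh)]
  choose h hh using h1
  refine ⟨fun γ => ρ (φ γ) (h γ), ⟨hh, fun γ γ' hne => ?_⟩, fun γ f hf => ?_⟩
  · have h0 : ρ (star (φ γ)) * ρ (φ γ') = 0 := by
      refine map_mul_map_eq_zero fun x hx => ?_
      by_contra hx'
      have h2 := hφ2 γ x (fun h => hx (by simp [h]))
      have h3 := hφ2 γ' x hx'
      have h4 := hc γ γ' hne
      have h5 := dist_triangle_left (c γ) (c γ') x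
      linarith
    change inner ℂ (ρ (φ γ) (h γ)) (ρ (φ γ') (h γ')) = 0
    rw [← ContinuousLinearMap.adjoint_inner_right, ← ContinuousLinearMap.star_eq_adjoint,
      ← map_star]
    have h1 : ρ (star (φ γ)) (ρ (φ γ') (h γ')) = 0 := DFunLike.congr_fun h0 (h γ')
    rw [h1, inner_zero_right]
  · by_contra! hall
    have h0 : ρ f * ρ (φ γ) = 0 := by
      refine map_mul_map_eq_zero fun x hx => ?_
      by_contra hx'
      exact absurd (hφ2 γ x hx') (not_lt.2 (hall x hx))
    exact hf (DFunLike.congr_fun h0 (h γ))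

/-- Only finitely many balls of radius `r / 4` about `r`-separated points meet a compact set. -/
theorem finite_ball_inter_compact {G : Type*} (c : G → Y) {r : ℝ}
    (hr : 0 < r) (hc : ∀ γ γ', γ ≠ γ' → r ≤ dist (c γ) (c γ')) {K : Set Y} (hK : IsCompact K) :
    {γ | ∃ z ∈ K, dist z (c γ) < r / 4}.Finite := by
  rcases isEmpty_or_nonempty G with hG | ⟨⟨γ₀⟩⟩
  · exact toFinite _
  have : Nonempty Y := ⟨c γ₀⟩
  obtain ⟨t, -, htf, ht⟩ := hK.finite_cover_balls (show 0 < r / 4 by positivity)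
  choose! z hz using fun γ (hγ : γ ∈ {γ | ∃ z ∈ K, dist z (c γ) < r / 4}) => hγ
  have h1 : ∀ γ, γ ∈ {γ | ∃ z ∈ K, dist z (c γ) < r / 4} → ∃ y ∈ t, dist (z γ) y < r / 4 := by
    intro γ hγ
    obtain ⟨y, hy, hzy⟩ := mem_iUnion₂.1 (ht (hz γ hγ).1)
    exact ⟨y, hy, hzy⟩
  choose! y hy using h1
  refine Finite.of_finite_image (f := y) (htf.subset ?_) ?_
  · rintro _ ⟨γ, hγ, rfl⟩
    exact (hy γ hγ).1
  · intro γ hγ γ' hγ' h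
    by_contra hne
    have h2 := hc γ γ' hne
    have h3 := (hz γ hγ).2
    have h4 := (hz γ' hγ').2
    have h5 := (hy γ hγ).2
    have h6 := (hy γ' hγ').2
    rw [h] at h5
    have h7 := dist_triangle_left (c γ) (c γ') (z γ)
    have h8 := dist_triangle (z γ) (z γ') (c γ')
    have h9 := dist_triangle_right (z γ) (z γ') (y γ')
    linarith

theorem partialIsometry_mem_roeAlgebra {G : Type*} {e : G → H} (he : Orthonormal ℂ e)
    (c : G → Y) {r : ℝ} (hr : 0 < r) (hc : ∀ γ γ', γ ≠ γ' → r ≤ dist (c γ) (c γ'))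
    (hloc : ∀ γ (f : C₀(Y, ℂ)), ρ f (e γ) ≠ 0 → ∃ z, f z ≠ 0 ∧ dist z (c γ) < r / 4) :
    partialIsometry he he ∈ roeAlgebra ρ := by
  have key : ∀ f : C₀(Y, ℂ), HasCompactSupport f →
      IsCompactOperator (ρ f * partialIsometry he he) := by
    intro f hf
    have hfin : {γ | ρ f (e γ) ≠ 0}.Finite :=
      (finite_ball_inter_compact c hr hc hf).subset fun γ hγ => by
        obtain ⟨z, hz, hd⟩ := hloc γ f hγ
        exact ⟨z, subset_tsupport _ hz, hd⟩
    have h1 := comp_partialIsometry_eq_sum he he (ρ f) hfin.toFinset fun γ hγ => by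
      by_contra h
      exact hγ (hfin.mem_toFinset.2 h)
    change IsCompactOperator (ρ f ∘L partialIsometry he he)
    rw [h1]
    exact Submodule.sum_mem (compactOperator (RingHom.id ℂ) H H) fun γ _ =>
      isCompactOperator_rankOne _ _
  have hstar : star (partialIsometry he he) = partialIsometry he he :=
    adjoint_partialIsometry he he
  refine mem_roeAlgebra (fun f hf => ⟨key f hf, ?_⟩) ⟨r / 2, by positivity, fun f g hfg => ?_⟩
  · have h := isCompactOperator_star (key (star f) (hasCompactSupport_star hf))
    rwa [star_mul, hstar, ← map_star, star_star] at h
  · rw [mul_assoc]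
    refine comp_partialIsometry_comp_eq_zero he he (ρ f) (ρ g) fun γ => ?_
    by_contra! h
    obtain ⟨h1, h2⟩ := h
    rw [← ContinuousLinearMap.star_eq_adjoint, ← map_star] at h2
    obtain ⟨z, hz, hzd⟩ := hloc γ f h1
    obtain ⟨z', hz', hzd'⟩ := hloc γ (star g) h2
    have h3 := hfg z (subset_tsupport _ hz) z' (subset_tsupport _ fun h => hz' (by simp [h]))
    have h4 := dist_triangle_right z z' (c γ)
    linarith

end LocalizedFamily

section Half

variable {X : Type*} [MetricSpace X] [LocallyCompactSpace X] {Y : Set X}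
  {H : Type*} [NormedAddCommGroup H] [InnerProductSpace ℂ H] [CompleteSpace H]
  {ρ : C₀(Y, ℂ) →⋆ₙₐ[ℂ] (H →L[ℂ] H)} {K : Type*} [NormedAddCommGroup K]
  [InnerProductSpace ℂ K] [CompleteSpace K] {σ : C₀(X, ℂ) →⋆ₙₐ[ℂ] (K →L[ℂ] K)}
  {ι : Type*} {g : ι → C₀(X, ℂ)} {V : ι → H →ₗᵢ[ℂ] K} {W : H →ₗᵢ[ℂ] K} {hY : IsClosed Y}

/-- If the Roe algebra of the closed set `Y` has trivial `K₀`, then the class of a projection on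
`X` with an orthonormal basis localized near points of `Y` vanishes. -/
theorem IsCovering.projClass_partialIsometry_eq_zero {D : ℝ} (hW : IsCovering ρ σ hY g V W D)
    (hρ : IsAmple ρ) (hσ : Dense (Submodule.span ℂ {v : K | ∃ f h, σ f h = v} : Set K))
    (hK : Subsingleton (KTheory.K0 (roeAlgebra ρ))) {G : Type*} (c : G → Y) {r : ℝ} (hr : 0 < r)
    (hc : ∀ γ γ', γ ≠ γ' → r ≤ dist (c γ) (c γ')) {w : G → K} (hw : Orthonormal ℂ w)
    (hloc : Finite G ∨ ∃ R : ℝ, ∀ γ (f : C₀(X, ℂ)), σ f (w γ) ≠ 0 →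
      ∃ z, f z ≠ 0 ∧ dist z (c γ) < R)
    (hmem : partialIsometry hw hw ∈ roeAlgebra σ)
    (hproj : IsStarProjection (⟨partialIsometry hw hw, hmem⟩ : roeAlgebra σ)) :
    KTheory.projClass (⟨partialIsometry hw hw, hmem⟩ : roeAlgebra σ) hproj = 0 := by
  have : LocallyCompactSpace Y := hY.locallyCompactSpace
  obtain ⟨e, he, heloc⟩ := hρ.exists_orthonormal c hr hc
  have hq := partialIsometry_mem_roeAlgebra he c hr hc heloc
  have hqproj : IsStarProjection (⟨partialIsometry he he, hq⟩ : roeAlgebra ρ) :=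
    ⟨Subtype.ext (isStarProjection_partialIsometry he).isIdempotentElem,
      Subtype.ext (isStarProjection_partialIsometry he).isSelfAdjoint⟩
  have hWe := he.comp_linearIsometry W
  have hconj : conjIsometry W (partialIsometry he he) = partialIsometry hWe hWe := by
    have h1 := isometry_comp_partialIsometry he he W
    have h2 := congrArg ContinuousLinearMap.adjoint h1
    rw [ContinuousLinearMap.adjoint_comp, adjoint_partialIsometry, adjoint_partialIsometry] at h2
    rw [conjIsometry_apply, h2, isometry_comp_partialIsometry he hWe W]
  have hφ : (hW.conjHom ⟨partialIsometry he he, hq⟩ : K →L[ℂ] K) = partialIsometry hWe hWe := hconj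
  have hq'mem : partialIsometry hWe hWe ∈ roeAlgebra σ := hφ ▸ (hW.conjHom _).2
  have humem : partialIsometry hw hWe ∈ roeAlgebra σ := by
    rcases hloc with hfin | ⟨R, hR⟩
    · have := Fintype.ofFinite G
      have h1 := comp_partialIsometry_eq_sum hw hWe (1 : K →L[ℂ] K) Finset.univ (fun γ hγ =>
        absurd (Finset.mem_univ γ) hγ)
      have h2 : partialIsometry hw hWe
          = ∑ γ, InnerProductSpace.rankOne ℂ (w γ) ((W ∘ e) γ) := h1
      rw [h2]
      exact sum_mem fun γ _ => hW.isSquarePartition.rankOne_mem_roeAlgebra hσ _ _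
    · refine mem_roeAlgebra (fun f hf => ⟨?_, ?_⟩) ⟨|R| + |D| + r, by positivity, fun f k hfk => ?_⟩
      · have h1 := (isLocallyCompact_of_mem_roeAlgebra hmem f hf).1
        have h2 := isCompactOperator_mul_right h1 (partialIsometry hw hWe)
        rw [mul_assoc] at h2
        have h3 : partialIsometry hw hw * partialIsometry hw hWe = partialIsometry hw hWe :=
          partialIsometry_comp hw hw hWe
        rwa [h3] at h2
      · have h1 := (isLocallyCompact_of_mem_roeAlgebra hq'mem f hf).2
        have h2 := isCompactOperator_mul_left h1 (partialIsometry hw hWe)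
        rw [← mul_assoc] at h2
        have h3 : partialIsometry hw hWe * partialIsometry hWe hWe = partialIsometry hw hWe :=
          partialIsometry_comp hw hWe hWe
        rwa [h3] at h2
      · rw [mul_assoc]
        refine comp_partialIsometry_comp_eq_zero hw hWe (σ f) (σ k) fun γ => ?_
        by_contra! h
        obtain ⟨h1, h2⟩ := h
        rw [← ContinuousLinearMap.star_eq_adjoint, ← map_star] at h2
        obtain ⟨z, hz, hzd⟩ := hR γ f h1
        refine h2 (hW.map_comp_eq_zero (star k) (e γ) fun i x hi hkx => ?_)
        by_contra h3
        obtain ⟨y, hy, hyd⟩ := heloc γ _ h3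
        have h4 := hW.dist_le i x y hi hy
        have h5 := hfk z (subset_tsupport _ hz) x (subset_tsupport _ fun h => hkx (by simp [h]))
        have h6 := dist_triangle4_right z x (c γ : X) (y : X)
        have h7 := le_abs_self D
        have h8 := le_abs_self R
        rw [Subtype.dist_eq, dist_comm] at hyd
        linarith
  have hq' : IsStarProjection (hW.conjHom ⟨partialIsometry he he, hq⟩) :=
    ⟨by rw [IsIdempotentElem, ← map_mul, hqproj.isIdempotentElem],
      by rw [IsSelfAdjoint, ← map_star, hqproj.isSelfAdjoint]⟩
  refine KTheory.projClass_eq_zero_of_equiv hq' hproj ⟨partialIsometry hw hWe, humem⟩ ?_ ?_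
    (KTheory.projClass_map_eq_zero hW.conjHom hqproj hq' (Subsingleton.elim _ _))
  · refine Subtype.ext ?_
    rw [hφ]
    change ContinuousLinearMap.adjoint (partialIsometry hw hWe) ∘L partialIsometry hw hWe = _
    rw [adjoint_partialIsometry, partialIsometry_comp]
  · refine Subtype.ext ?_
    change partialIsometry hw hWe ∘L ContinuousLinearMap.adjoint (partialIsometry hw hWe) = _
    rw [adjoint_partialIsometry, partialIsometry_comp]

end Half

end Coarse

namespace Coarse

section OrthonormalSelection

variable {K : Type*} [NormedAddCommGroup K] [InnerProductSpace ℂ K]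

theorem exists_norm_eq_one_mem_orthogonal {E : Submodule ℂ K} (hE : ¬ FiniteDimensional ℂ E)
    (F : Submodule ℂ K) [FiniteDimensional ℂ F] : ∃ x ∈ E, ‖x‖ = 1 ∧ ∀ y ∈ F, inner ℂ y x = 0 := by
  have h1 : ¬ Function.Injective ((F.orthogonalProjectionOnto : K →ₗ[ℂ] F) ∘ₗ E.subtype) :=
    fun h => hE (FiniteDimensional.of_injective _ h)
  rw [← LinearMap.ker_eq_bot, Submodule.eq_bot_iff] at h1
  push Not at h1
  obtain ⟨x, hx, hx0⟩ := h1
  have hx' : (x : K) ∈ Fᗮ := by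
    rw [← Submodule.orthogonalProjectionOnto_eq_zero_iff]
    exact hx
  have hn : ‖(x : K)‖ ≠ 0 := by simpa using hx0
  refine ⟨((‖(x : K)‖⁻¹ : ℝ) : ℂ) • (x : K), E.smul_mem _ x.2, ?_, fun y hy => ?_⟩
  · rw [norm_smul, Complex.norm_real, norm_inv, norm_norm, inv_mul_cancel₀ hn]
  · rw [inner_smul_right, hx' y hy, mul_zero]

theorem exists_orthonormal_nat_mem (E : ℕ → Submodule ℂ K) (hE : ∀ n, ¬ FiniteDimensional ℂ (E n)) :
    ∃ e : ℕ → K, Orthonormal ℂ e ∧ ∀ n, e n ∈ E n := by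
  have h1 : ∀ (n : ℕ) (F : {F : Submodule ℂ K // FiniteDimensional ℂ F}),
      ∃ x ∈ E n, ‖x‖ = 1 ∧ ∀ y ∈ F.1, inner ℂ y x = 0 := fun n F =>
    have := F.2
    exists_norm_eq_one_mem_orthogonal (hE n) F.1
  choose pick hp1 hp2 hp3 using h1
  let S : ℕ → {F : Submodule ℂ K // FiniteDimensional ℂ F} := fun n =>
    Nat.rec ⟨⊥, inferInstance⟩ (fun n F => ⟨F.1 ⊔ Submodule.span ℂ {pick n F},
      have := F.2
      inferInstance⟩) n
  have hmono : Monotone fun n => (S n).1 := monotone_nat_of_le_succ fun n => le_sup_left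
  have hmem : ∀ n, pick n (S n) ∈ (S (n + 1)).1 := fun n =>
    (le_sup_right : _ ≤ (S n).1 ⊔ Submodule.span ℂ {pick n (S n)})
      (Submodule.mem_span_singleton_self _)
  have hlt : ∀ m n, m < n → inner ℂ (pick m (S m)) (pick n (S n)) = 0 := fun m n hmn =>
    hp3 n (S n) _ (hmono hmn (hmem m))
  refine ⟨fun n => pick n (S n), ⟨fun n => hp2 _ _, fun m n hmn => ?_⟩, fun n => hp1 _ _⟩
  rcases lt_or_gt_of_ne hmn with h | h
  · exact hlt m n h
  · exact inner_eq_zero_symm.1 (hlt n m h)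

theorem exists_orthonormal_mem {J : Type*} [Countable J] (E : J → Submodule ℂ K)
    (hE : ∀ j, ¬ FiniteDimensional ℂ (E j)) : ∃ e : J → K, Orthonormal ℂ e ∧ ∀ j, e j ∈ E j := by
  rcases isEmpty_or_nonempty J with hJ | hJ
  · exact ⟨fun j => hJ.elim j, ⟨fun j => hJ.elim j, fun j => hJ.elim j⟩, fun j => hJ.elim j⟩
  obtain ⟨f, hf⟩ := exists_surjective_nat J
  obtain ⟨e, he, hmem⟩ := exists_orthonormal_nat_mem (fun n => E (f n)) fun n => hE (f n)
  refine ⟨fun j => e (Function.surjInv hf j), he.comp _ (Function.injective_surjInv hf), fun j => ?_⟩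
  have := hmem (Function.surjInv hf j)
  rwa [Function.surjInv_eq hf j] at this

theorem countable_of_orthonormal {H : Type*} [NormedAddCommGroup H] [InnerProductSpace ℂ H]
    [TopologicalSpace.SeparableSpace H] {β : Type*} {b : β → H} (hb : Orthonormal ℂ b) :
    Countable β := by
  refine Pairwise.countable_of_isOpen_disjoint (s := fun i => Metric.ball (b i) (1 / 2)) ?_
    (fun i => Metric.isOpen_ball) (fun i => ⟨b i, Metric.mem_ball_self (by norm_num)⟩)
  intro i j hij
  refine Metric.ball_disjoint_ball ?_
  have h1 : ‖b i - b j‖ ^ 2 = 2 := by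
    rw [@norm_sub_sq ℂ, hb.2 hij, hb.1 i, hb.1 j]
    norm_num
  rw [dist_eq_norm]
  nlinarith [norm_nonneg (b i - b j)]

variable [CompleteSpace K]

/-- Countably many infinite dimensional closed subspaces contain mutually orthogonal isometric
copies of any separable Hilbert space. -/
theorem exists_orthogonalFamily_mem {ι : Type*} [Countable ι] {H : Type*} [NormedAddCommGroup H]
    [InnerProductSpace ℂ H] [CompleteSpace H] [TopologicalSpace.SeparableSpace H]
    (E : ι → Submodule ℂ K) (hcl : ∀ i, IsClosed (E i : Set K))
    (hE : ∀ i, ¬ FiniteDimensional ℂ (E i)) :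
    ∃ V : ι → H →ₗᵢ[ℂ] K, OrthogonalFamily ℂ (fun _ : ι => H) V ∧ ∀ i h, V i h ∈ E i := by
  obtain ⟨β, b, -⟩ := exists_hilbertBasis ℂ H
  have := countable_of_orthonormal b.orthonormal
  obtain ⟨e, he, hmem⟩ := exists_orthonormal_mem (fun j : ι × β => E j.1) fun j => hE j.1
  have hei : ∀ i, Orthonormal ℂ fun x : β => e (i, x) := fun i =>
    he.comp (fun x : β => (i, x)) fun x y h => (Prod.mk.inj h).2
  let V : ι → H →ₗᵢ[ℂ] K := fun i =>
    (hei i).orthogonalFamily.linearIsometry.comp b.repr.toLinearIsometry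
  have hsum : ∀ i h, HasSum (fun x : β => b.repr h x • e (i, x)) (V i h) := fun i h =>
    (hei i).orthogonalFamily.hasSum_linearIsometry (b.repr h)
  refine ⟨V, fun i j hij h k => ?_, fun i h => ?_⟩
  · have h1 : ∀ x, inner ℂ (e (j, x)) (V i h) = 0 := fun x => by
      refine ((hsum i h).mapL (innerSL ℂ (e (j, x)))).unique ?_
      convert hasSum_zero using 2 with y
      rw [map_smul, innerSL_apply_apply, he.2 (fun h => hij (congrArg Prod.fst h).symm), smul_zero]
    refine ((hsum j k).mapL (innerSL ℂ (V i h))).unique ?_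
    convert hasSum_zero using 2 with y
    rw [map_smul, innerSL_apply_apply, inner_eq_zero_symm.1 (h1 y), smul_zero]
  · exact (hcl i).mem_of_tendsto (hsum i h) (Filter.Eventually.of_forall fun s =>
      (E i).sum_mem fun x _ => (E i).smul_mem _ (hmem (i, x)))

end OrthonormalSelection

theorem exists_isSquarePartition (X : Type*) [MetricSpace X] [LocallyCompactSpace X]
    [SecondCountableTopology X] : ∃ (s : Set X) (g : s → C₀(X, ℂ)), s.Countable ∧
      IsSquarePartition g ∧ (∀ i x y, g i x ≠ 0 → g i y ≠ 0 → dist x y ≤ 2) ∧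
      ∀ i, ∃ x, g i x ≠ 0 := by
  have h1 : ∀ x : X, ∃ s ∈ 𝓝 x, s ⊆ Metric.ball x 1 ∧ IsCompact s := fun x =>
    local_compact_nhds (Metric.ball_mem_nhds x zero_lt_one)
  choose N hN hNb hNc using h1
  obtain ⟨t, htc, ht⟩ := TopologicalSpace.countable_cover_nhds
    fun x => interior_mem_nhds.2 (hN x)
  obtain ⟨f, hf⟩ := PartitionOfUnity.exists_isSubordinate isClosed_univ
    (fun x : t => interior (N x)) (fun x => isOpen_interior) (by
      rw [← ht]; exact iUnion₂_subset fun x hx => subset_iUnion (fun x : t => interior (N x)) ⟨x, hx⟩)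
  have hsupp : ∀ i : t, tsupport (f i) ⊆ N i := fun i => (hf i).trans interior_subset
  have hcs : ∀ i : t, HasCompactSupport (f i) := fun i =>
    (hNc i).of_isClosed_subset (isClosed_tsupport _) (hsupp i)
  have hcs' : ∀ i : t, HasCompactSupport fun x => ((Real.sqrt (f i x) : ℝ) : ℂ) := fun i =>
    (hcs i).comp_left (g := fun r : ℝ => ((Real.sqrt r : ℝ) : ℂ)) (by simp)
  let G : t → C₀(X, ℂ) := fun i =>
    ⟨⟨fun x => ((Real.sqrt (f i x) : ℝ) : ℂ), by fun_prop⟩, (hcs' i).is_zero_at_infty⟩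
  have hG : ∀ i x, G i x = ((Real.sqrt (f i x) : ℝ) : ℂ) := fun i x => rfl
  have hG0 : ∀ i x, G i x ≠ 0 ↔ f i x ≠ 0 := fun i x => by
    rw [hG, Complex.ofReal_ne_zero, Ne, Real.sqrt_eq_zero (f.nonneg i x)]
  let u : Set X := {x | ∃ h : x ∈ t, ∃ y, G ⟨x, h⟩ y ≠ 0}
  have hut : ∀ x ∈ u, x ∈ t := fun x hx => hx.1
  have hinj : Function.Injective fun i : u => (⟨i, hut i i.2⟩ : t) := fun i j h =>
    Subtype.ext (congrArg (fun z : t => (z : X)) h)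
  refine ⟨u, fun i => G ⟨i, hut i i.2⟩, htc.mono hut, ⟨fun i => ?_, fun i => hcs' _, fun K hK => ?_,
    fun x => ?_⟩, fun i x y hx hy => ?_, fun i => i.2.2⟩
  · ext x
    rw [ZeroAtInftyContinuousMap.star_apply, hG]
    exact Complex.conj_ofReal _
  · have h2 := f.locallyFinite.finite_nonempty_inter_compact hK
    refine (h2.preimage hinj.injOn).subset ?_
    rintro i ⟨x, hx, hi⟩
    exact ⟨x, (hG0 _ x).1 hi, hx⟩
  · have h2 : HasSum (fun i => G i x * G i x) 1 := by
      have h3 : ∀ i, G i x * G i x = ((f i x : ℝ) : ℂ) := fun i => by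
        rw [hG, ← Complex.ofReal_mul, Real.mul_self_sqrt (f.nonneg i x)]
      simp only [h3]
      have h4 : HasSum (fun i => f i x) 1 := by
        rw [← f.sum_finsupport (mem_univ x)]
        refine hasSum_sum_of_ne_finset_zero fun i hi => ?_
        rw [PartitionOfUnity.mem_finsupport] at hi
        exact Function.notMem_support.1 hi
      have h5 := Complex.hasSum_ofReal.2 h4
      rwa [Complex.ofReal_one] at h5
    refine (hinj.hasSum_iff fun i hi => ?_).2 h2
    by_contra hne
    exact hi ⟨⟨i, i.2, x, fun h => hne (by rw [h, mul_zero])⟩, rfl⟩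
  · have h2 : ∀ z, G ⟨i, hut i i.2⟩ z ≠ 0 → dist z i < 1 := fun z hz =>
      hNb _ (hsupp _ (subset_tsupport _ ((hG0 _ z).1 hz)))
    have h3 := dist_triangle_right x y (i : X)
    linarith [h2 x hx, h2 y hy]

end Coarse

namespace Coarse

section MulRep

variable {X : Type*} [MetricSpace X] [MeasurableSpace X] [BorelSpace X] {μ : Measure X}

theorem mulRep_apply_eq_zero_iff {f : C₀(X, ℂ)} {x : Lp ℂ 2 μ} :
    mulRep μ f x = 0 ↔ ∀ᵐ y ∂μ, f y * x y = 0 := by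
  have h := coeFn_mulOp μ f x
  change mulOp μ f x = 0 ↔ _
  rw [Lp.eq_zero_iff_ae_eq_zero]
  constructor
  · intro h1
    filter_upwards [h, h1] with y h2 h3
    rw [← h2, h3]
    rfl
  · intro h1
    filter_upwards [h, h1] with y h2 h3
    rw [h2, h3]
    rfl

/-- The multiplication representation is nondegenerate. -/
theorem dense_span_mulRep {ι : Type*} [Countable ι] {g : ι → C₀(X, ℂ)}
    (hg : IsSquarePartition g) :
    Dense (Submodule.span ℂ {v : Lp ℂ 2 μ | ∃ f h, mulRep μ f h = v} : Set (Lp ℂ 2 μ)) := by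
  rw [Submodule.dense_iff_topologicalClosure_eq_top, Submodule.topologicalClosure_eq_top_iff,
    Submodule.eq_bot_iff]
  intro x hx
  have h1 : ∀ i, mulRep μ (g i) x = 0 := fun i => by
    have h2 := hx (mulRep μ (g i) (mulRep μ (g i) x)) (Submodule.subset_span ⟨_, _, rfl⟩)
    rw [← hg.isSelfAdjoint i, map_star, ContinuousLinearMap.star_eq_adjoint,
      ContinuousLinearMap.adjoint_inner_left, ← ContinuousLinearMap.star_eq_adjoint, ← map_star,
      hg.isSelfAdjoint i, inner_self_eq_zero] at h2
    exact h2
  rw [Lp.eq_zero_iff_ae_eq_zero]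
  have h3 : ∀ᵐ y ∂μ, ∀ i, g i y * x y = 0 :=
    ae_all_iff.2 fun i => mulRep_apply_eq_zero_iff.1 (h1 i)
  filter_upwards [h3] with y hy
  obtain ⟨i, hi⟩ : ∃ i, g i y ≠ 0 := by
    by_contra! hall
    have h4 := hg.hasSum y
    simp only [hall, mul_zero] at h4
    exact zero_ne_one (hasSum_zero.unique h4)
  exact (mul_eq_zero.1 (hy i)).resolve_left hi

theorem mulRep_apply_eq_zero_of_essSupport [SecondCountableTopology X] {f : C₀(X, ℂ)}
    {w : Lp ℂ 2 μ} (h : ∀ x ∈ essSupport μ w, f x = 0) : mulRep μ f w = 0 := by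
  rw [mulRep_apply_eq_zero_iff]
  have h1 : μ ((essSupport μ w)ᶜ ∩ Function.support w) = 0 := by
    refine measure_null_of_locally_null _ fun x hx => ?_
    have h2 : ¬ ∀ U ∈ 𝓝 x, μ (U ∩ Function.support w) ≠ 0 := hx.1
    push Not at h2
    obtain ⟨U, hU, hU0⟩ := h2
    exact ⟨U ∩ ((essSupport μ w)ᶜ ∩ Function.support w),
      Filter.inter_mem (mem_nhdsWithin_of_mem_nhds hU) self_mem_nhdsWithin,
      measure_mono_null (inter_subset_inter_right _ inter_subset_right) hU0⟩
  have h2 := compl_mem_ae_iff.2 h1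
  filter_upwards [h2] with x hx
  by_cases hxs : x ∈ essSupport μ w
  · rw [h x hxs, zero_mul]
  · have : w x = 0 := by
      by_contra h3
      exact hx ⟨hxs, h3⟩
    rw [this, mul_zero]

variable (μ) in
/-- The elements of `L²(X, μ)` which live on `U`. -/
def localSubmodule (U : Set X) : Submodule ℂ (Lp ℂ 2 μ) :=
  ⨅ (f : C₀(X, ℂ)) (_ : ∀ x ∈ U, f x = 0), (mulRep μ f).ker

theorem mem_localSubmodule {U : Set X} {x : Lp ℂ 2 μ} : x ∈ localSubmodule μ U ↔
    ∀ f : C₀(X, ℂ), (∀ x ∈ U, f x = 0) → mulRep μ f x = 0 := by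
  simp only [localSubmodule, Submodule.mem_iInf]
  rfl

theorem isClosed_localSubmodule (U : Set X) : IsClosed (localSubmodule μ U : Set (Lp ℂ 2 μ)) := by
  have : (localSubmodule μ U : Set (Lp ℂ 2 μ)) =
      ⋂ (f : C₀(X, ℂ)) (_ : ∀ x ∈ U, f x = 0), (mulRep μ f) ⁻¹' {0} := by
    ext x
    simp only [SetLike.mem_coe, mem_localSubmodule, mem_iInter, mem_preimage, mem_singleton_iff]
  rw [this]
  exact isClosed_iInter fun f => isClosed_iInter fun _ =>
    isClosed_singleton.preimage (mulRep μ f).continuous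

theorem not_finiteDimensional_localSubmodule
    (hμ : ∀ U : Set X, IsOpen U → U.Nonempty →
      ∃ S ⊆ U, MeasurableSet S ∧ μ S ≠ 0 ∧ μ S ≠ ⊤)
    {U : Set X} (hU : IsOpen U) (hinf : U.Infinite) :
    ¬ FiniteDimensional ℂ (localSubmodule μ U) := by
  have := hinf.to_subtype
  obtain ⟨A, hA1, hA2, hA3⟩ := exists_seq_infinite_isOpen_pairwise_disjoint U
  have h1 : ∀ n, ∃ S ⊆ (Subtype.val '' A n : Set X), MeasurableSet S ∧ μ S ≠ 0 ∧ μ S ≠ ⊤ :=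
    fun n => hμ _ (hU.isOpenMap_subtype_val _ (hA2 n)) ((hA1 n).nonempty.image _)
  choose S hS hSm hS0 hSt using h1
  have hdisj : ∀ m n, m ≠ n → Disjoint (S m) (S n) := fun m n hmn =>
    ((disjoint_image_iff Subtype.val_injective).2 (hA3 hmn)).mono (hS m) (hS n)
  let v : ℕ → Lp ℂ 2 μ := fun n => indicatorConstLp 2 (hSm n) (hSt n) (1 : ℂ)
  have hv : ∀ n, v n ∈ localSubmodule μ U := fun n => by
    rw [mem_localSubmodule]
    intro f hf
    rw [mulRep_apply_eq_zero_iff]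
    filter_upwards [indicatorConstLp_coeFn (p := 2) (hs := hSm n) (hμs := hSt n) (c := (1 : ℂ))]
      with x hx
    change f x * (indicatorConstLp 2 (hSm n) (hSt n) (1 : ℂ) : X → ℂ) x = 0
    rw [hx]
    by_cases hxS : x ∈ S n
    · obtain ⟨y, -, rfl⟩ := hS n hxS
      rw [hf _ y.2, zero_mul]
    · rw [indicator_of_notMem hxS, mul_zero]
  have hli : LinearIndependent ℂ v := by
    refine linearIndependent_of_ne_zero_of_inner_eq_zero (fun n h0 => ?_) fun m n hmn => ?_
    · have h2 : ‖v n‖ = μ.real (S n) ^ (1 / (2 : ℝ≥0∞).toReal) := by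
        refine (norm_indicatorConstLp (by simp) (by simp)).trans ?_
        simp
      rw [h0, norm_zero] at h2
      have h3 : 0 < μ.real (S n) := ENNReal.toReal_pos (hS0 n) (hSt n)
      exact absurd h2 (Real.rpow_pos_of_pos h3 _).ne
    · change inner ℂ (v m) (v n) = 0
      rw [L2.inner_indicatorConstLp_one (𝕜 := ℂ)]
      rw [setIntegral_congr_ae (g := fun _ => 0) (hSm m)]
      · simp
      · filter_upwards [indicatorConstLp_coeFn (p := 2) (hs := hSm n) (hμs := hSt n) (c := (1 : ℂ))]
          with x hx hxm
        change (indicatorConstLp 2 (hSm n) (hSt n) (1 : ℂ) : X → ℂ) x = 0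
        rw [hx, indicator_of_notMem (disjoint_left.1 (hdisj m n hmn) hxm)]
  intro hfin
  have h2 : LinearIndependent ℂ fun n => (⟨v n, hv n⟩ : localSubmodule μ U) :=
    LinearIndependent.of_comp (localSubmodule μ U).subtype hli
  exact not_finite_iff_infinite.2 inferInstance h2.finite

end MulRep

end Coarse

namespace Coarse

section Volume

variable {n : ℕ} {M : Type*} [TopologicalSpace M] [ChartedSpace (EuclideanSpace ℝ (Fin n)) M]

theorem continuousOn_coordField [IsManifold (𝓡 n) ∞ M] (c : M) (i : Fin n) :
    ContinuousOn (fun u => (⟨(chartAt (EuclideanSpace ℝ (Fin n)) c).symm u, coordField c u i⟩ :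
      TangentBundle (𝓡 n) M)) (chartAt (EuclideanSpace ℝ (Fin n)) c).target := by
  set e := chartAt (EuclideanSpace ℝ (Fin n)) c with he
  have h1 : ContMDiffOn (𝓡 n) (𝓡 n) ∞ e.symm e.target := contMDiffOn_chart_symm
  have h2 := h1.continuousOn_tangentMapWithin (by simp) e.open_target.uniqueMDiffOn
  have h3 : Continuous fun u : EuclideanSpace ℝ (Fin n) =>
      (⟨u, EuclideanSpace.single i 1⟩ : TangentBundle (𝓡 n) (EuclideanSpace ℝ (Fin n))) := by
    exact ((tangentBundleModelSpaceHomeomorph (𝓡 n)).symm.continuous.comp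
      (continuous_id.prodMk continuous_const) :)
  refine (h2.comp h3.continuousOn (fun u hu => hu)).congr fun u hu => ?_
  simp only [Function.comp_apply, tangentMapWithin, coordField,
    mfderivWithin_of_isOpen e.open_target hu]
  rfl

theorem linearIndependent_coordField [IsManifold (𝓡 n) ∞ M] (c : M) {u : EuclideanSpace ℝ (Fin n)}
    (hu : u ∈ (chartAt (EuclideanSpace ℝ (Fin n)) c).target) :
    LinearIndependent ℝ (coordField c u) := by
  have h1 := (mdifferentiable_chart (I := 𝓡 n) c).symm.ker_mfderiv_eq_bot hu
  have h2 : LinearIndependent ℝ fun i : Fin n => (EuclideanSpace.single i 1 :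
      EuclideanSpace ℝ (Fin n)) :=
    (EuclideanSpace.orthonormal_single).linearIndependent
  exact h2.map' _ h1

variable [RiemannianBundle (fun x : M => TangentSpace (𝓡 n) x)]

theorem continuousOn_sqrt_det_metricMatrix [IsManifold (𝓡 n) ∞ M]
    [IsContinuousRiemannianBundle (EuclideanSpace ℝ (Fin n))
      (fun x : M => TangentSpace (𝓡 n) x)] (c : M) :
    ContinuousOn (fun u => Real.sqrt (metricMatrix c u).det)
      (chartAt (EuclideanSpace ℝ (Fin n)) c).target := by
  refine Real.continuous_sqrt.comp_continuousOn ?_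
  have h1 : ContinuousOn (fun u => metricMatrix c u)
      (chartAt (EuclideanSpace ℝ (Fin n)) c).target := by
    refine continuousOn_pi.2 fun i => continuousOn_pi.2 fun j => ?_
    exact (continuousOn_coordField c i).inner_bundle (continuousOn_coordField c j)
  exact (continuous_id.matrix_det).comp_continuousOn h1

theorem sqrt_det_metricMatrix_pos [IsManifold (𝓡 n) ∞ M] (c : M) {u : EuclideanSpace ℝ (Fin n)}
    (hu : u ∈ (chartAt (EuclideanSpace ℝ (Fin n)) c).target) :
    0 < Real.sqrt (metricMatrix c u).det := by
  have h1 : (metricMatrix c u).PosDef := by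
    have h2 := linearIndependent_coordField c hu
    have h3 : metricMatrix c u = Matrix.gram ℝ (coordField c u) := rfl
    rw [h3]
    exact Matrix.posDef_gram_of_linearIndependent h2
  exact Real.sqrt_pos.2 h1.det_pos

theorem chartVolume_apply [MeasurableSpace M] [BorelSpace M] (c : M) {S : Set M}
    (hS : MeasurableSet S) :
    chartVolume (n := n) c S = ∫⁻ u in (chartAt (EuclideanSpace ℝ (Fin n)) c).symm ⁻¹' S ∩
      (chartAt (EuclideanSpace ℝ (Fin n)) c).target,
        ENNReal.ofReal (Real.sqrt (metricMatrix c u).det) := by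
  set e := chartAt (EuclideanSpace ℝ (Fin n)) c with he
  have h1 : AEMeasurable e.symm (volume.restrict e.target) :=
    e.continuousOn_symm.aemeasurable e.open_target.measurableSet
  rw [chartVolume, Measure.map_apply_of_aemeasurable
    (h1.mono_ac (withDensity_absolutelyContinuous _ _)) hS, withDensity_apply',
    Measure.restrict_restrict' e.open_target.measurableSet]

/-- Every nonempty open subset of a Riemannian manifold contains a set of positive finite
volume. -/
theorem exists_subset_riemannianVolume [IsManifold (𝓡 n) ∞ M] [SecondCountableTopology M] [MeasurableSpace M]
    [BorelSpace M] [IsContinuousRiemannianBundle (EuclideanSpace ℝ (Fin n))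
      (fun x : M => TangentSpace (𝓡 n) x)] (U : Set M) (hU : IsOpen U) (hne : U.Nonempty) :
    ∃ S ⊆ U, MeasurableSet S ∧ riemannianVolume n M S ≠ 0 ∧ riemannianVolume n M S ≠ ⊤ := by
  have hex : ∃ c : chartCenters n M,
      (U ∩ (chartAt (EuclideanSpace ℝ (Fin n)) (c : M)).source).Nonempty := by
    obtain ⟨x, hx⟩ := hne
    have h1 : x ∈ ⋃ c ∈ chartCenters n M, (chartAt (EuclideanSpace ℝ (Fin n)) c).source :=
      (exists_countable_chart_cover n M).choose_spec.2 ▸ mem_univ x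
    obtain ⟨c, hc, hxc⟩ := mem_iUnion₂.1 h1
    exact ⟨⟨c, hc⟩, x, hx, hxc⟩
  obtain ⟨c, hc, hmin⟩ := WellFounded.has_min
    (measure fun c : chartCenters n M => Encodable.encode c).wf
    {c | (U ∩ (chartAt (EuclideanSpace ℝ (Fin n)) (c : M)).source).Nonempty} hex
  set e := chartAt (EuclideanSpace ℝ (Fin n)) (c : M) with he
  obtain ⟨x, hxU, hxe⟩ := hc
  have hT : IsOpen (e.target ∩ e.symm ⁻¹' U) := e.isOpen_inter_preimage_symm hU
  have hxT : e x ∈ e.target ∩ e.symm ⁻¹' U :=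
    ⟨e.map_source hxe, by rw [mem_preimage, e.left_inv hxe]; exact hxU⟩
  obtain ⟨ε, hε, hball⟩ := Metric.nhds_basis_closedBall.mem_iff.1 (hT.mem_nhds hxT)
  set S := e.source ∩ e ⁻¹' Metric.ball (e x) ε with hSdef
  have hSo : IsOpen S := e.isOpen_inter_preimage Metric.isOpen_ball
  have hSU : S ⊆ U := fun y hy => by
    have := (hball (Metric.ball_subset_closedBall hy.2)).2
    rwa [mem_preimage, e.left_inv hy.1] at this
  have hpiece : S ⊆ chartPiece c := fun y hy =>
    ⟨hy.1, fun c' hc' hyc' => hmin c' ⟨y, hSU hy, hyc'⟩ hc'⟩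
  have hother : ∀ c' : chartCenters n M, c' ≠ c → S ∩ chartPiece c' = ∅ := by
    intro c' hc'
    refine eq_empty_iff_forall_notMem.2 fun y hy => ?_
    rcases lt_trichotomy (Encodable.encode c') (Encodable.encode c) with h | h | h
    · exact hmin c' ⟨y, hSU hy.1, hy.2.1⟩ h
    · exact hc' (Encodable.encode_injective h)
    · exact hy.2.2 c h hy.1.1
  have hvol : riemannianVolume n M S = ∫⁻ u in Metric.ball (e x) ε,
      ENNReal.ofReal (Real.sqrt (metricMatrix (c : M) u).det) := by
    have h1 : e.symm ⁻¹' S ∩ e.target = Metric.ball (e x) ε := by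
      ext u
      constructor
      · rintro ⟨h1, h2⟩
        have := h1.2
        rwa [mem_preimage, e.right_inv h2] at this
      · intro h1
        have h2 := (hball (Metric.ball_subset_closedBall h1)).1
        exact ⟨⟨e.map_target h2, by rw [mem_preimage, e.right_inv h2]; exact h1⟩, h2⟩
    rw [riemannianVolume, Measure.sum_apply _ hSo.measurableSet, tsum_eq_single c]
    · rw [Measure.restrict_apply hSo.measurableSet, inter_eq_left.2 hpiece,
        chartVolume_apply _ hSo.measurableSet, ← he, h1]
    · intro c' hc'
      rw [Measure.restrict_apply hSo.measurableSet, hother c' hc', measure_empty]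
  have hcont : ContinuousOn (fun u => Real.sqrt (metricMatrix (c : M) u).det)
      (Metric.closedBall (e x) ε) :=
    (continuousOn_sqrt_det_metricMatrix (c : M)).mono fun u hu => (hball hu).1
  have hcpt : IsCompact (Metric.closedBall (e x) ε) := isCompact_closedBall _ _
  have hcne : (Metric.closedBall (e x) ε).Nonempty := ⟨e x, Metric.mem_closedBall_self hε.le⟩
  obtain ⟨u₀, hu₀, hu₀min⟩ := hcpt.exists_isMinOn hcne hcont
  obtain ⟨u₁, hu₁, hu₁max⟩ := hcpt.exists_isMaxOn hcne hcont
  refine ⟨S, hSU, hSo.measurableSet, ?_, ?_⟩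
  · have h1 : ENNReal.ofReal (Real.sqrt (metricMatrix (c : M) u₀).det) *
        volume (Metric.ball (e x) ε) ≤ riemannianVolume n M S := by
      rw [hvol, ← setLIntegral_const]
      exact setLIntegral_mono' Metric.isOpen_ball.measurableSet fun u hu =>
        ENNReal.ofReal_le_ofReal (hu₀min (Metric.ball_subset_closedBall hu))
    refine (lt_of_lt_of_le (ENNReal.mul_pos ?_ ?_) h1).ne'
    · exact (ENNReal.ofReal_pos.2 (sqrt_det_metricMatrix_pos (c : M) (hball hu₀).1)).ne'
    · exact (Metric.measure_ball_pos _ _ hε).ne'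
  · have h1 : riemannianVolume n M S ≤ ENNReal.ofReal (Real.sqrt (metricMatrix (c : M) u₁).det) *
        volume (Metric.ball (e x) ε) := by
      rw [hvol, ← setLIntegral_const]
      exact setLIntegral_mono' Metric.isOpen_ball.measurableSet fun u hu =>
        ENNReal.ofReal_le_ofReal (hu₁max (Metric.ball_subset_closedBall hu))
    exact (lt_of_le_of_lt h1 (ENNReal.mul_lt_top ENNReal.ofReal_lt_top measure_ball_lt_top)).ne

end Volume

end Coarse

namespace KTheory

/-- A projection which is absorbed by another one gives rise to an isometric matrix with a
prescribed defect. -/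
theorem MatProj.exists_isometry_of_single_dsum_mvN {B : Type*} [Ring B] [StarRing B] {e : B}
    {he : IsStarProjection e} {r : MatProj B} (h : MatProj.MvN ((MatProj.single e he).dsum r) r) :
    ∃ (T : Matrix (Fin r.size) (Fin r.size) B) (v : Matrix (Fin r.size) (Fin 1) B),
      Tᴴ * T = 1 ∧ vᴴ * T = 0 ∧ vᴴ * v = Matrix.of fun _ _ => e := by
  set P : Matrix (Fin 1) (Fin 1) B := Matrix.of fun _ _ => e with hP
  set R : Matrix (Fin r.size) (Fin r.size) B := r.mat with hR
  obtain ⟨w, hw1, hw2⟩ : ∃ w : Matrix (Fin r.size) (Fin (1 + r.size)) B,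
      wᴴ * w = Matrix.reindex finSumFinEquiv finSumFinEquiv (Matrix.fromBlocks P 0 0 R) ∧
        w * wᴴ = R := h
  have hR1 : Rᴴ = R := r.isProj.isSelfAdjoint
  have hR2 : R * R = R := r.isProj.isIdempotentElem
  have hP1 : Pᴴ = P := (MatProj.single e he).isProj.isSelfAdjoint
  have hP2 : P * P = P := (MatProj.single e he).isProj.isIdempotentElem
  obtain ⟨V₀, hV1, hV2⟩ : ∃ V₀ : Matrix (Fin r.size) (Fin 1 ⊕ Fin r.size) B,
      V₀ᴴ * V₀ = Matrix.fromBlocks P 0 0 R ∧ V₀ * V₀ᴴ = R := by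
    refine ⟨w.submatrix id finSumFinEquiv, ?_, ?_⟩
    · have h1 : (w.submatrix id finSumFinEquiv)ᴴ * w.submatrix id finSumFinEquiv
          = (wᴴ * w).submatrix finSumFinEquiv finSumFinEquiv := by
        ext i j
        simp [Matrix.mul_apply]
      rw [h1, hw1]
      ext i j
      simp only [Matrix.reindex_apply, Matrix.submatrix_apply, Equiv.symm_apply_apply]
    · rw [← hw2]
      ext i j
      simp only [Matrix.mul_apply, Matrix.submatrix_apply, Matrix.conjTranspose_apply, id]
      exact finSumFinEquiv.sum_comp fun l => w i l * star (w j l)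
  set Q := Matrix.fromBlocks P 0 0 R with hQ
  have hQ1 : Qᴴ = Q := by
    rw [hQ, Matrix.fromBlocks_conjTranspose, hP1, hR1, Matrix.conjTranspose_zero,
      Matrix.conjTranspose_zero]
  have hQ2 : Q * Q = Q := by
    rw [hQ, Matrix.fromBlocks_multiply, hP2, hR2]
    simp
  obtain ⟨V, hVR, hVQ⟩ : ∃ V : Matrix (Fin r.size) (Fin 1 ⊕ Fin r.size) B,
      R * V = V ∧ Vᴴ * V = Q := by
    refine ⟨R * V₀ * Q, by rw [← Matrix.mul_assoc, ← Matrix.mul_assoc, hR2], ?_⟩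
    calc (R * V₀ * Q)ᴴ * (R * V₀ * Q) = Q * (V₀ᴴ * (R * R) * V₀) * Q := by
          simp only [Matrix.conjTranspose_mul, hQ1, hR1, Matrix.mul_assoc]
      _ = Q * (V₀ᴴ * V₀ * (V₀ᴴ * V₀)) * Q := by
          rw [hR2]
          conv_lhs => rw [← hV2]
          simp only [Matrix.mul_assoc]
      _ = Q := by rw [hV1, hQ2, hQ2, hQ2]
  obtain ⟨v, u, rfl⟩ : ∃ (v : Matrix (Fin r.size) (Fin 1) B)
      (u : Matrix (Fin r.size) (Fin r.size) B), V = Matrix.fromCols v u :=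
    ⟨V.toCols₁, V.toCols₂, (Matrix.fromCols_toCols V).symm⟩
  rw [Matrix.mul_fromCols, Matrix.fromCols_ext_iff] at hVR
  rw [Matrix.conjTranspose_fromCols_eq_fromRows_conjTranspose, Matrix.fromRows_mul_fromCols, hQ,
    Matrix.fromBlocks_inj] at hVQ
  obtain ⟨hRv, hRu⟩ := hVR
  obtain ⟨hvv, hvu, huv, huu⟩ := hVQ
  have hvR : vᴴ * R = vᴴ := by
    have := congrArg Matrix.conjTranspose hRv
    rwa [Matrix.conjTranspose_mul, hR1] at this
  have huR : uᴴ * R = uᴴ := by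
    have := congrArg Matrix.conjTranspose hRu
    rwa [Matrix.conjTranspose_mul, hR1] at this
  refine ⟨u + (1 - R), v, ?_, ?_, hvv⟩
  · rw [Matrix.conjTranspose_add, Matrix.conjTranspose_sub, Matrix.conjTranspose_one, hR1]
    simp only [Matrix.add_mul, Matrix.mul_add, Matrix.sub_mul, Matrix.mul_sub, huu, huR, hRu, hR2,
      Matrix.one_mul, Matrix.mul_one]
    abel
  · simp only [Matrix.mul_add, Matrix.mul_sub, hvu, hvR, Matrix.mul_one]
    abel

section Compact

variable {H : Type*} [NormedAddCommGroup H] [NormedSpace ℂ H]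

/-- The operator on `H^k` given by a matrix of operators. -/
def matrixOperator {k : Type*} [Fintype k] (S : Matrix k k (H →L[ℂ] H)) :
    (k → H) →L[ℂ] (k → H) :=
  ContinuousLinearMap.pi fun i => ∑ j, (S i j) ∘L ContinuousLinearMap.proj j

variable {k : Type*} [Fintype k]

theorem matrixOperator_apply (S : Matrix k k (H →L[ℂ] H)) (x : k → H) (i : k) :
    matrixOperator S x i = ∑ j, S i j (x j) := by
  simp [matrixOperator]

theorem matrixOperator_mul (S T : Matrix k k (H →L[ℂ] H)) :
    matrixOperator (S * T) = matrixOperator S * matrixOperator T := by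
  ext x i
  change matrixOperator (S * T) x i = matrixOperator S (matrixOperator T x) i
  simp only [matrixOperator_apply, Matrix.mul_apply, _root_.sum_apply, map_sum]
  rw [Finset.sum_comm]
  rfl

theorem matrixOperator_one [DecidableEq k] :
    matrixOperator (1 : Matrix k k (H →L[ℂ] H)) = 1 := by
  ext x i
  rw [matrixOperator_apply, Finset.sum_eq_single i]
  · simp
  · intro j _ hj
    simp [Matrix.one_apply_ne' hj]
  · simp

theorem matrixOperator_add (S T : Matrix k k (H →L[ℂ] H)) :
    matrixOperator (S + T) = matrixOperator S + matrixOperator T := by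
  ext x i
  simp [matrixOperator_apply, Finset.sum_add_distrib]

theorem matrixOperator_injective :
    Function.Injective (matrixOperator : Matrix k k (H →L[ℂ] H) → _) := by
  classical
  intro S T h
  ext i j x
  have h1 := congrFun (DFunLike.congr_fun h (Pi.single j x)) i
  rw [matrixOperator_apply, matrixOperator_apply, Finset.sum_eq_single j,
    Finset.sum_eq_single j] at h1
  · simpa using h1
  all_goals simp +contextual

theorem isCompactOperator_matrixOperator {S : Matrix k k (H →L[ℂ] H)}
    (hS : ∀ i j, IsCompactOperator (S i j)) : IsCompactOperator (matrixOperator S) := by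
  classical
  have h1 : matrixOperator S = ∑ i, ∑ j, (ContinuousLinearMap.single ℂ (fun _ : k => H) i) ∘L
      (S i j) ∘L ContinuousLinearMap.proj j := by
    ext x i
    simp [matrixOperator_apply, Finset.sum_apply, Pi.single_apply]
  rw [h1]
  exact Submodule.sum_mem (compactOperator (RingHom.id ℂ) _ _) fun i _ =>
    Submodule.sum_mem _ fun j _ => ((hS i j).comp_clm
      (ContinuousLinearMap.proj (R := ℂ) (φ := fun _ : k => H) j)).clm_comp
      (ContinuousLinearMap.single ℂ (fun _ : k => H) i)

/-- An isometric matrix which is a compact perturbation of the identity is unitary. -/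
theorem mul_conjTranspose_eq_one_of_compact {H : Type*} [NormedAddCommGroup H]
    [InnerProductSpace ℂ H] [CompleteSpace H] [DecidableEq k] {S : Matrix k k (H →L[ℂ] H)}
    (h : Sᴴ * S = 1) (hS : ∀ i j, IsCompactOperator ((S - 1) i j)) : S * Sᴴ = 1 := by
  have h1 : matrixOperator Sᴴ * matrixOperator S = 1 := by
    rw [← matrixOperator_mul, h, matrixOperator_one]
  have h2 : matrixOperator S = 1 + matrixOperator (S - 1) := by
    rw [← matrixOperator_one, ← matrixOperator_add, add_sub_cancel]
  have h3 : IsCompactOperator (-matrixOperator (S - 1)) :=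
    (isCompactOperator_matrixOperator hS).neg
  apply matrixOperator_injective
  rw [matrixOperator_mul, matrixOperator_one]
  rcases IsCompactOperator.hasEigenvalue_or_mem_resolventSet h3 (one_ne_zero (α := ℂ)) with h4 | h4
  · obtain ⟨x, hx⟩ := h4.exists_hasEigenvector
    have h5 : -(matrixOperator (S - 1) x) = x := by simpa using hx.apply_eq_smul
    have h6 : matrixOperator S x = 0 := by
      rw [h2]
      change x + matrixOperator (S - 1) x = 0
      nth_rewrite 1 [← h5]
      exact neg_add_cancel _
    refine absurd ?_ hx.2
    have h7 : matrixOperator Sᴴ (matrixOperator S x) = x := DFunLike.congr_fun h1 x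
    rw [← h7, h6, map_zero]
  · have h5 : IsUnit (matrixOperator S) := by
      rw [spectrum.mem_resolventSet_iff] at h4
      rw [h2]
      simpa [sub_neg_eq_add] using h4
    obtain ⟨u, hu⟩ := h5
    rw [← hu] at h1 ⊢
    have h6 : matrixOperator Sᴴ = ↑u⁻¹ := by
      rw [← mul_one (matrixOperator Sᴴ), ← u.mul_inv, ← mul_assoc, h1, one_mul]
    rw [h6, u.mul_inv]

variable {H : Type*} [NormedAddCommGroup H] [InnerProductSpace ℂ H] [CompleteSpace H]
  {A : NonUnitalStarSubalgebra ℂ (H →L[ℂ] H)}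

/-- The unital extension of the inclusion of an operator algebra. -/
def unitizationInclusion (A : NonUnitalStarSubalgebra ℂ (H →L[ℂ] H)) :
    Unitization ℂ A →⋆ₐ[ℂ] (H →L[ℂ] H) :=
  Unitization.starLift (NonUnitalStarSubalgebraClass.subtype A)

theorem unitizationInclusion_apply (x : Unitization ℂ A) :
    unitizationInclusion A x = algebraMap ℂ (H →L[ℂ] H) x.fst + (x.snd : H →L[ℂ] H) := rfl

theorem isometry_map_mul_conjTranspose (hA : ∀ a ∈ A, IsCompactOperator a) [DecidableEq k]
    {T : Matrix k k (Unitization ℂ A)} (hT : Tᴴ * T = 1) :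
    T.map (unitizationInclusion A) * (T.map (unitizationInclusion A))ᴴ = 1 := by
  set φ := unitizationInclusion A
  have hφT : (T.map φ)ᴴ * T.map φ = 1 := by
    rw [← Matrix.conjTranspose_map _ (fun x => map_star φ x), ← Matrix.map_mul, hT]
    exact Matrix.map_one _ (map_zero φ) (map_one φ)
  have h0 : (T.map (scalarPart A))ᴴ * T.map (scalarPart A) = 1 := by
    rw [← Matrix.conjTranspose_map _ (fun x => map_star (scalarPart A) x), ← Matrix.map_mul, hT]
    exact Matrix.map_one _ (map_zero _) (map_one _)
  have h0' : T.map (scalarPart A) * (T.map (scalarPart A))ᴴ = 1 := mul_eq_one_comm.1 h0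
  let α : ℂ →⋆ₐ[ℂ] (H →L[ℂ] H) := StarAlgHom.ofId ℂ (H →L[ℂ] H)
  set D : Matrix k k (H →L[ℂ] H) := (T.map (scalarPart A)).map α with hD
  have h1 : Dᴴ * D = 1 := by
    rw [hD, ← Matrix.conjTranspose_map _ (fun x => map_star α x), ← Matrix.map_mul, h0]
    exact Matrix.map_one _ (map_zero α) (map_one α)
  have h2 : D * Dᴴ = 1 := by
    rw [hD, ← Matrix.conjTranspose_map _ (fun x => map_star α x), ← Matrix.map_mul, h0']
    exact Matrix.map_one _ (map_zero α) (map_one α)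
  have hdiff : ∀ i j, IsCompactOperator ((T.map φ - D) i j) := fun i j => by
    have h3 : (T.map φ - D) i j = ((T i j).snd : H →L[ℂ] H) := by
      change (algebraMap ℂ (H →L[ℂ] H) (T i j).fst + ((T i j).snd : H →L[ℂ] H))
        - algebraMap ℂ (H →L[ℂ] H) (T i j).fst = _
      exact add_sub_cancel_left _ _
    rw [h3]
    exact hA _ (T i j).snd.2
  have hS1 : (Dᴴ * T.map φ)ᴴ * (Dᴴ * T.map φ) = 1 := by
    rw [Matrix.conjTranspose_mul, Matrix.conjTranspose_conjTranspose, Matrix.mul_assoc,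
      ← Matrix.mul_assoc D, h2, Matrix.one_mul, hφT]
  have hS2 : ∀ i j, IsCompactOperator ((Dᴴ * T.map φ - 1) i j) := fun i j => by
    rw [← h1, ← Matrix.mul_sub, Matrix.mul_apply]
    exact Submodule.sum_mem (compactOperator (RingHom.id ℂ) H H) fun l _ =>
      (hdiff l j).clm_comp (Dᴴ i l)
  have h3 := mul_conjTranspose_eq_one_of_compact hS1 hS2
  have h4 : T.map φ = D * (Dᴴ * T.map φ) := by rw [← Matrix.mul_assoc, h2, Matrix.one_mul]
  rw [h4, Matrix.conjTranspose_mul D, Matrix.mul_assoc, ← Matrix.mul_assoc (Dᴴ * T.map φ), h3,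
    Matrix.one_mul, h2]

/-- In an algebra of compact operators, only the zero projection has trivial class in `K₀`. -/
theorem eq_zero_of_projClass_eq_zero (hA : ∀ a ∈ A, IsCompactOperator a) {e : A}
    (he : IsStarProjection e) (h : projClass e he = 0) : e = 0 := by
  rw [projClass_eq_zero_iff] at h
  obtain ⟨r, hr⟩ := UnitalK0.exists_dsum_mvN_of_mk_eq_zero h
  obtain ⟨T, v, hT, hvT, hv⟩ := MatProj.exists_isometry_of_single_dsum_mvN hr
  have h1 := isometry_map_mul_conjTranspose hA hT
  have h2 : (v.map (unitizationInclusion A))ᴴ * T.map (unitizationInclusion A) = 0 := by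
    rw [← Matrix.conjTranspose_map _ (fun x => map_star _ x), ← Matrix.map_mul, hvT]
    exact Matrix.map_zero _ (map_zero _)
  have h3 : (v.map (unitizationInclusion A))ᴴ = 0 := by
    rw [← Matrix.mul_one (v.map (unitizationInclusion A))ᴴ, ← h1, ← Matrix.mul_assoc, h2,
      Matrix.zero_mul]
  have h4 : (vᴴ * v).map (unitizationInclusion A) = 0 := by
    rw [Matrix.map_mul, Matrix.conjTranspose_map _ (fun x => map_star _ x), h3, Matrix.zero_mul]
  rw [hv] at h4
  have h5 : unitizationInclusion A (e : Unitization ℂ A) = 0 := congrFun (congrFun h4 0) 0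
  rw [unitizationInclusion_apply, Unitization.fst_inr, map_zero, zero_add,
    Unitization.snd_inr] at h5
  exact Subtype.ext h5

end Compact

end KTheory

namespace Coarse

section Decomposition

variable {X : Type*} [MetricSpace X] {K : Type*} [NormedAddCommGroup K]
  [InnerProductSpace ℂ K] [CompleteSpace K] {σ : C₀(X, ℂ) →⋆ₙₐ[ℂ] (K →L[ℂ] K)}
  {ι : Type*} {g : ι → C₀(X, ℂ)}

/-- If a projection in the Roe algebra fixes a localized orthonormal family, then the projection
onto the closed span of this family also lies in the Roe algebra. -/
theorem partialIsometry_mem_roeAlgebra_of_fixed (hg : IsSquarePartition g)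
    (hσ : Dense (Submodule.span ℂ {v : K | ∃ f h, σ f h = v} : Set K)) {p : K →L[ℂ] K}
    (hp : p ∈ roeAlgebra σ) {G : Type*} {c : G → X} {w : G → K} (hw : Orthonormal ℂ w)
    (hfix : ∀ γ, p (w γ) = w γ)
    (hloc : Finite G ∨ ∃ R : ℝ, ∀ γ (f : C₀(X, ℂ)), σ f (w γ) ≠ 0 →
      ∃ z, f z ≠ 0 ∧ dist z (c γ) < R) :
    partialIsometry hw hw ∈ roeAlgebra σ := by
  rcases hloc with hfin | ⟨R, hR⟩
  · have := Fintype.ofFinite G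
    have h1 := comp_partialIsometry_eq_sum hw hw (1 : K →L[ℂ] K) Finset.univ
      fun γ hγ => absurd (Finset.mem_univ γ) hγ
    have h2 : partialIsometry hw hw = ∑ γ, InnerProductSpace.rankOne ℂ (w γ) (w γ) := h1
    rw [h2]
    exact sum_mem fun γ _ => hg.rankOne_mem_roeAlgebra hσ _ _
  have hstar : star (partialIsometry hw hw) = partialIsometry hw hw :=
    adjoint_partialIsometry hw hw
  have hpq : p * partialIsometry hw hw = partialIsometry hw hw := by
    have h1 := comp_partialIsometry_comp_eq_zero hw hw (p - 1) (1 : K →L[ℂ] K) fun γ =>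
      Or.inl (by simp [hfix γ])
    have h2 : (p - 1) * partialIsometry hw hw = 0 := h1
    rwa [sub_mul, one_mul, sub_eq_zero] at h2
  have key : ∀ f : C₀(X, ℂ), HasCompactSupport f →
      IsCompactOperator (σ f * partialIsometry hw hw) := fun f hf => by
    rw [← hpq, ← mul_assoc]
    exact isCompactOperator_mul_right (isLocallyCompact_of_mem_roeAlgebra hp f hf).1 _
  refine mem_roeAlgebra (fun f hf => ⟨key f hf, ?_⟩) ⟨2 * |R| + 1, by positivity, fun f k hfk => ?_⟩
  · have h := isCompactOperator_star (key (star f) (hasCompactSupport_star hf))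
    rwa [star_mul, hstar, ← map_star, star_star] at h
  · rw [mul_assoc]
    refine comp_partialIsometry_comp_eq_zero hw hw (σ f) (σ k) fun γ => ?_
    by_contra! h
    obtain ⟨h1, h2⟩ := h
    rw [← ContinuousLinearMap.star_eq_adjoint, ← map_star] at h2
    obtain ⟨z, hz, hzd⟩ := hR γ f h1
    obtain ⟨z', hz', hzd'⟩ := hR γ (star k) h2
    have h3 := hfk z (subset_tsupport _ hz) z' (subset_tsupport _ fun h => hz' (by simp [h]))
    have h4 := dist_triangle_right z z' (c γ)
    have h5 := le_abs_self R
    linarith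

variable [LocallyCompactSpace X] {X₁ X₂ : Set X} {hX₁ : IsClosed X₁} {hX₂ : IsClosed X₂}
  {H₁ : Type*} [NormedAddCommGroup H₁] [InnerProductSpace ℂ H₁] [CompleteSpace H₁]
  {ρ₁ : C₀(X₁, ℂ) →⋆ₙₐ[ℂ] (H₁ →L[ℂ] H₁)}
  {H₂ : Type*} [NormedAddCommGroup H₂] [InnerProductSpace ℂ H₂] [CompleteSpace H₂]
  {ρ₂ : C₀(X₂, ℂ) →⋆ₙₐ[ℂ] (H₂ →L[ℂ] H₂)}
  {V₁ : ι → H₁ →ₗᵢ[ℂ] K} {W₁ : H₁ →ₗᵢ[ℂ] K} {V₂ : ι → H₂ →ₗᵢ[ℂ] K} {W₂ : H₂ →ₗᵢ[ℂ] K}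

/-- A projection with a localized orthonormal basis has vanishing class if the space is the union
of two closed sets whose Roe algebras have trivial `K₀`. -/
theorem projClass_eq_zero_of_isCovering {D₁ D₂ : ℝ} (hW₁ : IsCovering ρ₁ σ hX₁ g V₁ W₁ D₁)
    (hW₂ : IsCovering ρ₂ σ hX₂ g V₂ W₂ D₂) (hρ₁ : IsAmple ρ₁) (hρ₂ : IsAmple ρ₂)
    (hσ : Dense (Submodule.span ℂ {v : K | ∃ f h, σ f h = v} : Set K))
    (hK₁ : Subsingleton (KTheory.K0 (roeAlgebra ρ₁)))
    (hK₂ : Subsingleton (KTheory.K0 (roeAlgebra ρ₂))) (hX : X₁ ∪ X₂ = univ)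
    {p : roeAlgebra σ} (hp : IsStarProjection p) {Γ : Set X} {r : ℝ} (hr : 0 < r)
    (hΓ : ∀ γ γ' : Γ, γ ≠ γ' → r ≤ dist (γ : X) γ') {w : Γ → K} (hw : Orthonormal ℂ w)
    (hspan : (Submodule.span ℂ (range w)).topologicalClosure
      = LinearMap.range (p : K →L[ℂ] K).toLinearMap)
    (hloc : Finite Γ ∨ ∃ R : ℝ, ∀ (γ : Γ) (f : C₀(X, ℂ)), σ f (w γ) ≠ 0 →
      ∃ z, f z ≠ 0 ∧ dist z (γ : X) < R) :
    KTheory.projClass p hp = 0 := by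
  have hpp : (p : K →L[ℂ] K) * p = p := congrArg Subtype.val hp.isIdempotentElem
  have hps : star (p : K →L[ℂ] K) = p := congrArg Subtype.val hp.isSelfAdjoint
  have hfix : ∀ γ, (p : K →L[ℂ] K) (w γ) = w γ := fun γ => by
    have h1 : w γ ∈ LinearMap.range (p : K →L[ℂ] K).toLinearMap := by
      rw [← hspan]
      exact Submodule.le_topologicalClosure _ (Submodule.subset_span (mem_range_self γ))
    obtain ⟨x, hx⟩ := h1
    rw [← hx]
    exact DFunLike.congr_fun hpp x
  let G₁ := {γ : Γ // (γ : X) ∈ X₁}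
  let G₂ := {γ : Γ // (γ : X) ∉ X₁}
  have hmem₂ : ∀ γ : G₂, ((γ : Γ) : X) ∈ X₂ := fun γ =>
    ((hX.ge (mem_univ ((γ : Γ) : X))).resolve_left γ.2)
  have hw₁ : Orthonormal ℂ fun γ : G₁ => w γ := hw.comp _ Subtype.val_injective
  have hw₂ : Orthonormal ℂ fun γ : G₂ => w γ := hw.comp _ Subtype.val_injective
  have hloc₁ : Finite G₁ ∨ ∃ R : ℝ, ∀ (γ : G₁) (f : C₀(X, ℂ)), σ f (w γ) ≠ 0 →
      ∃ z, f z ≠ 0 ∧ dist z ((γ : Γ) : X) < R :=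
    hloc.imp (fun (_ : Finite Γ) => Subtype.finite) fun ⟨R, hR⟩ => ⟨R, fun γ => hR γ⟩
  have hloc₂ : Finite G₂ ∨ ∃ R : ℝ, ∀ (γ : G₂) (f : C₀(X, ℂ)), σ f (w γ) ≠ 0 →
      ∃ z, f z ≠ 0 ∧ dist z ((γ : Γ) : X) < R :=
    hloc.imp (fun (_ : Finite Γ) => Subtype.finite) fun ⟨R, hR⟩ => ⟨R, fun γ => hR γ⟩
  have hm₁ : partialIsometry hw₁ hw₁ ∈ roeAlgebra σ :=
    partialIsometry_mem_roeAlgebra_of_fixed hW₁.isSquarePartition hσ p.2 hw₁ (fun γ => hfix γ) hloc₁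
  have hm₂ : partialIsometry hw₂ hw₂ ∈ roeAlgebra σ :=
    partialIsometry_mem_roeAlgebra_of_fixed hW₁.isSquarePartition hσ p.2 hw₂ (fun γ => hfix γ) hloc₂
  have hp₁ : IsStarProjection (⟨_, hm₁⟩ : roeAlgebra σ) :=
    ⟨Subtype.ext (isStarProjection_partialIsometry hw₁).isIdempotentElem,
      Subtype.ext (isStarProjection_partialIsometry hw₁).isSelfAdjoint⟩
  have hp₂ : IsStarProjection (⟨_, hm₂⟩ : roeAlgebra σ) :=
    ⟨Subtype.ext (isStarProjection_partialIsometry hw₂).isIdempotentElem,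
      Subtype.ext (isStarProjection_partialIsometry hw₂).isSelfAdjoint⟩
  have hz₁ : KTheory.projClass (⟨_, hm₁⟩ : roeAlgebra σ) hp₁ = 0 :=
    hW₁.projClass_partialIsometry_eq_zero hρ₁ hσ hK₁ (fun γ : G₁ => ⟨((γ : Γ) : X), γ.2⟩) hr
      (fun γ γ' h => hΓ γ γ' fun e => h (Subtype.ext e)) hw₁ hloc₁ hm₁ hp₁
  have hz₂ : KTheory.projClass (⟨_, hm₂⟩ : roeAlgebra σ) hp₂ = 0 :=
    hW₂.projClass_partialIsometry_eq_zero hρ₂ hσ hK₂ (fun γ : G₂ => ⟨((γ : Γ) : X), hmem₂ γ⟩) hr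
      (fun γ γ' h => hΓ γ γ' fun e => h (Subtype.ext e)) hw₂ hloc₂ hm₂ hp₂
  have horth : Pairwise fun γ γ' : Γ => inner ℂ (w γ) (w γ') = 0 := hw.2
  have h11 : ∀ γ : G₁, partialIsometry hw₁ hw₁ (w γ) = w γ := partialIsometry_apply_self hw₁ hw₁
  have h22 : ∀ γ : G₂, partialIsometry hw₂ hw₂ (w γ) = w γ := partialIsometry_apply_self hw₂ hw₂
  have h12 : ∀ γ : G₂, partialIsometry hw₁ hw₁ (w γ) = 0 := fun γ => by
    refine (hasSum_partialIsometry hw₁ hw₁ _).unique ?_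
    convert hasSum_zero using 2 with γ'
    have hne : (γ' : Γ) ≠ γ := fun h => γ.2 (h ▸ γ'.2)
    rw [horth hne, zero_smul]
  have h21 : ∀ γ : G₁, partialIsometry hw₂ hw₂ (w γ) = 0 := fun γ => by
    refine (hasSum_partialIsometry hw₂ hw₂ _).unique ?_
    convert hasSum_zero using 2 with γ'
    have hne : (γ' : Γ) ≠ γ := fun h => γ'.2 (h ▸ γ.2)
    rw [horth hne, zero_smul]
  have hpq : partialIsometry hw₁ hw₁ * partialIsometry hw₂ hw₂ = 0 :=
    comp_partialIsometry_comp_eq_zero hw₂ hw₂ (partialIsometry hw₁ hw₁) (1 : K →L[ℂ] K)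
      fun γ => Or.inl (h12 γ)
  have hqp : ∀ {G : Type _} {a : G → K} (ha : Orthonormal ℂ a),
      (∀ γ, (p : K →L[ℂ] K) (a γ) = a γ) →
        partialIsometry ha ha * (p : K →L[ℂ] K) = partialIsometry ha ha := fun ha h => by
    have h1 := comp_partialIsometry_comp_eq_zero ha ha (1 : K →L[ℂ] K) ((p : K →L[ℂ] K) - 1)
      fun γ => Or.inr (by
        rw [← ContinuousLinearMap.star_eq_adjoint, star_sub, hps, star_one]
        simp [h γ])
    have h2 : partialIsometry ha ha * ((p : K →L[ℂ] K) - 1) = 0 := h1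
    rwa [mul_sub, mul_one, sub_eq_zero] at h2
  have hadd : partialIsometry hw₁ hw₁ + partialIsometry hw₂ hw₂ = (p : K →L[ℂ] K) := by
    set A : K →L[ℂ] K := partialIsometry hw₁ hw₁ + partialIsometry hw₂ hw₂ - p with hA
    have hA0 : ∀ γ, A (w γ) = 0 := fun γ => by
      change partialIsometry hw₁ hw₁ (w γ) + partialIsometry hw₂ hw₂ (w γ)
        - (p : K →L[ℂ] K) (w γ) = 0
      by_cases hγ : (γ : X) ∈ X₁
      · rw [h11 ⟨γ, hγ⟩, h21 ⟨γ, hγ⟩, hfix, add_zero, sub_self]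
      · rw [h12 ⟨γ, hγ⟩, h22 ⟨γ, hγ⟩, hfix, zero_add, sub_self]
    have hle : (Submodule.span ℂ (range w)).topologicalClosure ≤ A.ker :=
      Submodule.topologicalClosure_minimal _
        (Submodule.span_le.2 (range_subset_iff.2 hA0)) A.isClosed_ker
    have hAp : A * (p : K →L[ℂ] K) = 0 := by
      ext x
      exact hle (hspan.ge (LinearMap.mem_range_self (p : K →L[ℂ] K).toLinearMap x))
    rw [hA, sub_mul, add_mul, hpp, hqp hw₁ fun γ => hfix γ, hqp hw₂ fun γ => hfix γ] at hAp
    exact sub_eq_zero.1 hAp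
  exact KTheory.projClass_eq_zero_of_add hp₁ hp₂ hp (Subtype.ext hadd) (Subtype.ext hpq) hz₁ hz₂

end Decomposition

end Coarse

namespace Coarse

section UniformlyDiscrete

variable {X : Type*} [MetricSpace X] {Γ : Set X}

theorem UniformlyDiscrete.exists_le_dist (hΓ : UniformlyDiscrete Γ) :
    ∃ r : ℝ, 0 < r ∧ ∀ γ γ' : Γ, γ ≠ γ' → r ≤ dist (γ : X) γ' := by
  obtain ⟨r, hr, h⟩ := hΓ
  refine ⟨r, hr, fun γ γ' hne => ?_⟩
  by_contra! hd
  exact Set.disjoint_left.1 (h γ.2 γ'.2 fun e => hne (Subtype.ext e))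
    (Metric.mem_ball'.2 hd) (Metric.mem_ball_self hr)

theorem packingRadius_le_edist {γ γ' : X} (h : γ ∈ Γ) (h' : γ' ∈ Γ) (hne : γ ≠ γ') :
    packingRadius Γ ≤ edist γ γ' := by
  refine sSup_le fun r hr => ?_
  by_contra! hd
  exact Set.disjoint_left.1 (hr h h' hne) (Metric.mem_eball'.2 hd)
    (Metric.mem_eball_self (pos_of_gt hd))

theorem IsWannierBasis.finite_or_localized [SecondCountableTopology X] [MeasurableSpace X]
    [BorelSpace X] {μ : Measure X} {S : Submodule ℂ (Lp ℂ 2 μ)} {w : Γ → Lp ℂ 2 μ}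
    (hw : IsWannierBasis μ Γ S w) :
    Finite Γ ∨ ∃ R : ℝ, ∀ (γ : Γ) (f : C₀(X, ℂ)), mulRep μ f (w γ) ≠ 0 →
      ∃ z, f z ≠ 0 ∧ dist z (γ : X) < R := by
  by_cases htop : packingRadius Γ = ⊤
  · left
    have : Subsingleton Γ := ⟨fun γ γ' => by
      by_contra hne
      have h1 := packingRadius_le_edist γ.2 γ'.2 fun e => hne (Subtype.ext e)
      rw [htop, top_le_iff] at h1
      exact edist_ne_top _ _ h1⟩
    infer_instance
  · refine Or.inr ⟨(packingRadius Γ).toReal, fun γ f hf => ?_⟩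
    by_contra! h
    refine hf (mulRep_apply_eq_zero_of_essSupport fun x hx => ?_)
    by_contra hfx
    have h1 := h x hfx
    have h2 := hw.support_subset γ hx
    rw [Metric.mem_eball, edist_dist, ENNReal.ofReal_lt_iff_lt_toReal dist_nonneg htop] at h2
    exact absurd h2 h1.not_gt

end UniformlyDiscrete

section Union

variable {X : Type*} [MetricSpace X] [LocallyCompactSpace X] {K : Type*} [NormedAddCommGroup K]
  [InnerProductSpace ℂ K] [CompleteSpace K] {σ : C₀(X, ℂ) →⋆ₙₐ[ℂ] (K →L[ℂ] K)}
  {X₁ X₂ : Set X} (hX₁ : IsClosed X₁) (hX₂ : IsClosed X₂)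
  {H₁ : Type*} [NormedAddCommGroup H₁] [InnerProductSpace ℂ H₁] [CompleteSpace H₁]
  {ρ₁ : C₀(X₁, ℂ) →⋆ₙₐ[ℂ] (H₁ →L[ℂ] H₁)}
  {H₂ : Type*} [NormedAddCommGroup H₂] [InnerProductSpace ℂ H₂] [CompleteSpace H₂]
  {ρ₂ : C₀(X₂, ℂ) →⋆ₙₐ[ℂ] (H₂ →L[ℂ] H₂)}

theorem UniformlyDiscrete.projClass_eq_zero
    (hcov : ∃ (s : Set X) (g : s → C₀(X, ℂ)) (D : ℝ),
      (∃ V W, IsCovering ρ₁ σ hX₁ g V W D) ∧ ∃ V W, IsCovering ρ₂ σ hX₂ g V W D)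
    (hρ₁ : IsAmple ρ₁) (hρ₂ : IsAmple ρ₂)
    (hσ : Dense (Submodule.span ℂ {v : K | ∃ f h, σ f h = v} : Set K))
    (hK₁ : Subsingleton (KTheory.K0 (roeAlgebra ρ₁)))
    (hK₂ : Subsingleton (KTheory.K0 (roeAlgebra ρ₂))) (hX : X₁ ∪ X₂ = univ)
    {p : roeAlgebra σ} (hp : IsStarProjection p) {Γ : Set X} (hΓ : UniformlyDiscrete Γ)
    (hw : ∃ w : Γ → K, Orthonormal ℂ w ∧ (Submodule.span ℂ (range w)).topologicalClosure
        = LinearMap.range (p : K →L[ℂ] K).toLinearMap ∧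
      (Finite Γ ∨ ∃ R : ℝ, ∀ (γ : Γ) (f : C₀(X, ℂ)), σ f (w γ) ≠ 0 →
        ∃ z, f z ≠ 0 ∧ dist z (γ : X) < R)) :
    KTheory.projClass p hp = 0 := by
  obtain ⟨s, g, D, ⟨V₁, W₁, hW₁⟩, ⟨V₂, W₂, hW₂⟩⟩ := hcov
  obtain ⟨r, hr, hΓr⟩ := hΓ.exists_le_dist
  obtain ⟨w, hw, hspan, hloc⟩ := hw
  exact projClass_eq_zero_of_isCovering hW₁ hW₂ hρ₁ hρ₂ hσ hK₁ hK₂ hX hp hr hΓr hw hspan hloc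

end Union

section Covering

variable {X : Type*} [MetricSpace X] [MeasurableSpace X] [BorelSpace X] {μ : Measure X}
  {Y : Set X} {H : Type*} [NormedAddCommGroup H] [InnerProductSpace ℂ H] [CompleteSpace H]
  {ρ : C₀(Y, ℂ) →⋆ₙₐ[ℂ] (H →L[ℂ] H)} {ι : Type*} [Countable ι] {g : ι → C₀(X, ℂ)}

theorem exists_isCovering (hρ : IsAmple ρ) (hY : IsClosed Y) (hg : IsSquarePartition g) {D : ℝ}
    (hD : ∀ i x y, g i x ≠ 0 → g i y ≠ 0 → dist x y ≤ D) (hne : ∀ i, ∃ x, g i x ≠ 0)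
    (hinf : ∀ U : Set X, IsOpen U → U.Nonempty → U.Infinite)
    (hμ : ∀ U : Set X, IsOpen U → U.Nonempty → ∃ S ⊆ U, MeasurableSet S ∧ μ S ≠ 0 ∧ μ S ≠ ⊤) :
    ∃ (V : ι → H →ₗᵢ[ℂ] Lp ℂ 2 μ) (W : H →ₗᵢ[ℂ] Lp ℂ 2 μ),
      IsCovering ρ (mulRep μ) hY g V W D := by
  have := hρ.separable
  have hopen : ∀ i, IsOpen {x | g i x ≠ 0} := fun i => isOpen_ne_fun (g i).continuous (by fun_prop)
  obtain ⟨V, hV, hVE⟩ := exists_orthogonalFamily_mem (H := H)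
    (fun i => localSubmodule μ {x | g i x ≠ 0}) (fun i => isClosed_localSubmodule _)
    fun i => not_finiteDimensional_localSubmodule hμ (hopen i) (hinf _ (hopen i) (hne i))
  obtain ⟨W, hW⟩ := exists_sumIsometry (hg.restrict hY) hρ.nondegenerate hV
  exact ⟨V, W, hg, hW, fun i f hf h => mem_localSubmodule.1 (hVE i h) f hf, hD⟩

/-- On a space without isolated points whose nonempty open sets have nonzero measure, a projection
with a compactly supported Wannier basis has vanishing class if the space is the union of two
closed sets whose Roe algebras have trivial `K₀`. -/
theorem projClass_eq_zero_of_isWannierBasis [LocallyCompactSpace X] [SecondCountableTopology X]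
    (hinf : ∀ U : Set X, IsOpen U → U.Nonempty → U.Infinite)
    (hμ : ∀ U : Set X, IsOpen U → U.Nonempty → ∃ S ⊆ U, MeasurableSet S ∧ μ S ≠ 0 ∧ μ S ≠ ⊤)
    {X₁ X₂ : Set X} (hX₁ : IsClosed X₁) (hX₂ : IsClosed X₂) (hX : X₁ ∪ X₂ = univ)
    {H₁ : Type*} [NormedAddCommGroup H₁] [InnerProductSpace ℂ H₁] [CompleteSpace H₁]
    {ρ₁ : C₀(X₁, ℂ) →⋆ₙₐ[ℂ] (H₁ →L[ℂ] H₁)} (hρ₁ : IsAmple ρ₁)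
    {H₂ : Type*} [NormedAddCommGroup H₂] [InnerProductSpace ℂ H₂] [CompleteSpace H₂]
    {ρ₂ : C₀(X₂, ℂ) →⋆ₙₐ[ℂ] (H₂ →L[ℂ] H₂)} (hρ₂ : IsAmple ρ₂)
    (hK₁ : Subsingleton (KTheory.K0 (roeAlgebra ρ₁)))
    (hK₂ : Subsingleton (KTheory.K0 (roeAlgebra ρ₂)))
    {p : roeAlgebra (mulRep μ)} (hp : IsStarProjection p) {Γ : Set X} (hΓ : UniformlyDiscrete Γ)
    (hw : ∃ w : Γ → Lp ℂ 2 μ, IsWannierBasis μ Γ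
      (LinearMap.range (p : Lp ℂ 2 μ →L[ℂ] Lp ℂ 2 μ).toLinearMap) w) :
    KTheory.projClass p hp = 0 := by
  have hσ : Dense (Submodule.span ℂ {v : Lp ℂ 2 μ | ∃ f h, mulRep μ f h = v} : Set (Lp ℂ 2 μ)) := by
    obtain ⟨s, g, hs, hg, -⟩ := exists_isSquarePartition X
    have := hs.to_subtype
    exact dense_span_mulRep hg
  have hcov : ∃ (s : Set X) (g : s → C₀(X, ℂ)) (D : ℝ),
      (∃ V W, IsCovering ρ₁ (mulRep μ) hX₁ g V W D) ∧
        ∃ V W, IsCovering ρ₂ (mulRep μ) hX₂ g V W D := by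
    obtain ⟨s, g, hs, hg, hD, hne⟩ := exists_isSquarePartition X
    have := hs.to_subtype
    exact ⟨s, g, 2, exists_isCovering hρ₁ hX₁ hg hD hne hinf hμ,
      exists_isCovering hρ₂ hX₂ hg hD hne hinf hμ⟩
  exact hΓ.projClass_eq_zero hX₁ hX₂ hcov hρ₁ hρ₂ hσ hK₁ hK₂ hX hp
    (hw.imp fun w hw => ⟨hw.orthonormal, hw.span_eq, hw.finite_or_localized⟩)

end Covering

section Point

/-- The Roe algebra of a point consists of compact operators, hence has nontrivial `K₀`. -/
theorem IsAmple.not_subsingleton_K0 {Y : Type*} [MetricSpace Y] [CompactSpace Y] [Nonempty Y]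
    {H : Type*} [NormedAddCommGroup H] [InnerProductSpace ℂ H] [CompleteSpace H]
    {ρ : C₀(Y, ℂ) →⋆ₙₐ[ℂ] (H →L[ℂ] H)} (hρ : IsAmple ρ) :
    ¬ Subsingleton (KTheory.K0 (roeAlgebra ρ)) := by
  intro hK
  let f : C₀(Y, ℂ) := ⟨⟨fun _ => 1, continuous_const⟩, by simp⟩
  have hfapp : ∀ y, f y = 1 := fun _ => rfl
  have hf : HasCompactSupport f := HasCompactSupport.of_compactSpace _
  have hmul : ∀ k : C₀(Y, ℂ), f * k = k := fun k => by
    ext y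
    rw [ZeroAtInftyContinuousMap.mul_apply, hfapp, one_mul]
  have hone : ρ f = 1 := by
    have h1 : (ρ f : H → H) = id := by
      refine Continuous.ext_on hρ.nondegenerate (ρ f).continuous continuous_id fun v hv => ?_
      have h2 : Submodule.span ℂ {v : H | ∃ f h, ρ f h = v} ≤ (ρ f - 1).ker := by
        refine Submodule.span_le.2 ?_
        rintro _ ⟨k, h, rfl⟩
        have h3 : ρ f (ρ k h) = ρ k h := by
          conv_rhs => rw [← hmul k, map_mul]
          rfl
        change ρ f (ρ k h) - ρ k h = 0
        rw [h3, sub_self]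
      exact sub_eq_zero.1 (h2 hv)
    ext v
    exact congrFun h1 v
  have hA : ∀ a ∈ roeAlgebra ρ, IsCompactOperator a := fun a ha => by
    have h := (isLocallyCompact_of_mem_roeAlgebra ha f hf).1
    rwa [hone, one_mul] at h
  have hnt : Nontrivial H := by
    by_contra hH
    rw [not_nontrivial_iff_subsingleton] at hH
    obtain ⟨y⟩ := ‹Nonempty Y›
    refine hρ.not_compact f (fun h => one_ne_zero (α := ℂ) ?_) ?_
    · rw [← hfapp y, h]
      rfl
    · rw [Subsingleton.elim (ρ f) 0]
      exact isCompactOperator_zero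
  obtain ⟨x, hx⟩ := exists_norm_eq H zero_le_one
  have hmem : InnerProductSpace.rankOne ℂ x x ∈ roeAlgebra ρ := by
    have h := rankOne_mem_roeAlgebra_of_hasCompactSupport (ρ := ρ) x x hf hf
    rwa [hone] at h
  have he : IsStarProjection (⟨_, hmem⟩ : roeAlgebra ρ) := by
    refine ⟨Subtype.ext ?_, Subtype.ext ?_⟩
    · ext v
      change inner ℂ x (inner ℂ x v • x) • x = inner ℂ x v • x
      rw [inner_smul_right, inner_self_eq_norm_sq_to_K, hx]
      simp
    · exact InnerProductSpace.adjoint_rankOne x x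
  have h0 := congrArg Subtype.val
    (KTheory.eq_zero_of_projClass_eq_zero hA he (Subsingleton.elim _ _))
  have h1 : InnerProductSpace.rankOne ℂ x x x = 0 := DFunLike.congr_fun h0 x
  rw [InnerProductSpace.rankOne_apply, inner_self_eq_norm_sq_to_K, hx] at h1
  have h2 : x = 0 := by simpa using h1
  rw [h2, norm_zero] at hx
  exact zero_ne_one hx

end Point

section Manifold

theorem infinite_of_isOpen {n : ℕ} {M : Type*} [TopologicalSpace M]
    [ChartedSpace (EuclideanSpace ℝ (Fin n)) M] (hn : n ≠ 0) {U : Set M} (hU : IsOpen U)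
    (hne : U.Nonempty) : U.Infinite := by
  obtain ⟨x, hx⟩ := hne
  set e := chartAt (EuclideanSpace ℝ (Fin n)) x
  have : Nonempty (Fin n) := Fin.pos_iff_nonempty.1 (Nat.pos_of_ne_zero hn)
  have h1 : IsOpen (e '' (e.source ∩ U)) := e.isOpen_image_source_inter hU
  have h2 : (e '' (e.source ∩ U)).Infinite :=
    infinite_of_mem_nhds (e x) (h1.mem_nhds ⟨x, ⟨mem_chart_source _ x, hx⟩, rfl⟩)
  exact (h2.of_image e).mono inter_subset_right

theorem subsingleton_of_isRiemannianManifold_zero {n : ℕ} (hn : n = 0) {M : Type*} [MetricSpace M]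
    [ChartedSpace (EuclideanSpace ℝ (Fin n)) M]
    [RiemannianBundle (fun x : M => TangentSpace (𝓡 n) x)] [IsRiemannianManifold (𝓡 n) M] :
    Subsingleton M := by
  subst hn
  have : DiscreteTopology M := discreteTopology_iff_isOpen_singleton.2 fun x => by
    convert (chartAt (EuclideanSpace ℝ (Fin 0)) x).open_source
    ext y
    refine ⟨fun h => ?_, fun h => ?_⟩
    · rw [mem_singleton_iff.1 h]
      exact mem_chart_source _ x
    · exact (chartAt (EuclideanSpace ℝ (Fin 0)) x).injOn h (mem_chart_source _ x)
        (Subsingleton.elim _ _)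
  refine ⟨fun x y => ?_⟩
  have h1 : riemannianEDist (𝓡 0) x y < ⊤ := by
    rw [← IsRiemannianManifold.out (I := 𝓡 0) x y]
    exact edist_lt_top x y
  obtain ⟨γ, h0, h1, hγ, -⟩ := exists_lt_of_riemannianEDist_lt h1
  have h2 := (isPreconnected_Icc (a := (0 : ℝ)) (b := 1)).image γ hγ.continuousOn
  rw [← h0, ← h1]
  exact h2.subsingleton ⟨0, by simp, rfl⟩ ⟨1, by simp, rfl⟩

variable (n : ℕ) (M : Type*) [TopologicalSpace M] [ChartedSpace (EuclideanSpace ℝ (Fin n)) M]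
  [IsManifold (𝓡 n) ∞ M] [RiemannianBundle (fun x : M => TangentSpace (𝓡 n) x)]
  [IsContMDiffRiemannianBundle (𝓡 n) ∞ (EuclideanSpace ℝ (Fin n))
    (fun x : M => TangentSpace (𝓡 n) x)]

theorem isContinuousRiemannianBundle :
    IsContinuousRiemannianBundle (EuclideanSpace ℝ (Fin n))
      (fun x : M => TangentSpace (𝓡 n) x) := by
  obtain ⟨g, hg1, hg2⟩ := IsContMDiffRiemannianBundle.exists_contMDiff (IB := 𝓡 n) (n := ∞)
    (F := EuclideanSpace ℝ (Fin n)) (E := fun x : M => TangentSpace (𝓡 n) x)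
  exact ⟨g, hg1.continuous, hg2⟩

end Manifold

end Coarse

end

theorem proposition2p5 {n : ℕ} {M : Type*} [MetricSpace M] [SecondCountableTopology M]
    [ChartedSpace (EuclideanSpace ℝ (Fin n)) M] [IsManifold (𝓡 n) ∞ M]
    [RiemannianBundle (fun x : M => TangentSpace (𝓡 n) x)]
    [IsContMDiffRiemannianBundle (𝓡 n) ∞ (EuclideanSpace ℝ (Fin n))
      (fun x : M => TangentSpace (𝓡 n) x)]
    [IsRiemannianManifold (𝓡 n) M] [MeasurableSpace M] [BorelSpace M]
    (X₁ X₂ : Set M) (hX₁ : IsClosed X₁) (hX₂ : IsClosed X₂) (hX : X₁ ∪ X₂ = Set.univ)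
    {H₁ : Type*} [NormedAddCommGroup H₁] [InnerProductSpace ℂ H₁] [CompleteSpace H₁]
    (ρ₁ : C₀(X₁, ℂ) →⋆ₙₐ[ℂ] (H₁ →L[ℂ] H₁)) (hρ₁ : Coarse.IsAmple ρ₁)
    {H₂ : Type*} [NormedAddCommGroup H₂] [InnerProductSpace ℂ H₂] [CompleteSpace H₂]
    (ρ₂ : C₀(X₂, ℂ) →⋆ₙₐ[ℂ] (H₂ →L[ℂ] H₂)) (hρ₂ : Coarse.IsAmple ρ₂)
    (hK₁ : Subsingleton (KTheory.K0 (Coarse.roeAlgebra ρ₁)))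
    (hK₂ : Subsingleton (KTheory.K0 (Coarse.roeAlgebra ρ₂)))
    (p : Coarse.roeAlgebra (Coarse.mulRep (Coarse.riemannianVolume n M)))
    (hp : IsStarProjection p) (Γ : Set M) (hΓ : Coarse.UniformlyDiscrete Γ)
    (hw : ∃ w : Γ → Lp ℂ 2 (Coarse.riemannianVolume n M),
      Coarse.IsWannierBasis (Coarse.riemannianVolume n M) Γ
        (LinearMap.range (p : Lp ℂ 2 (Coarse.riemannianVolume n M) →L[ℂ]
          Lp ℂ 2 (Coarse.riemannianVolume n M)).toLinearMap) w) :
    KTheory.projClass p hp = 0 := by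
  by_cases hn : n = 0
  · have hM : Subsingleton M := Coarse.subsingleton_of_isRiemannianManifold_zero hn
    have hM' : IsEmpty M := ⟨fun x => by
      have : CompactSpace M := inferInstance
      rcases hX.ge (mem_univ x) with h | h
      · have : CompactSpace X₁ := isCompact_iff_compactSpace.1 hX₁.isCompact
        have : Nonempty X₁ := ⟨x, h⟩
        exact hρ₁.not_subsingleton_K0 hK₁
      · have : CompactSpace X₂ := isCompact_iff_compactSpace.1 hX₂.isCompact
        have : Nonempty X₂ := ⟨x, h⟩
        exact hρ₂.not_subsingleton_K0 hK₂⟩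
    exact KTheory.projClass_zero_of_eq_zero hp (Subtype.ext (ContinuousLinearMap.ext fun f =>
      Lp.ext (Filter.Eventually.of_forall fun x => hM'.elim x)))
  have : LocallyCompactSpace M := ChartedSpace.locallyCompactSpace (EuclideanSpace ℝ (Fin n)) M
  have : IsContinuousRiemannianBundle (EuclideanSpace ℝ (Fin n))
      (fun x : M => TangentSpace (𝓡 n) x) := Coarse.isContinuousRiemannianBundle n M
  exact Coarse.projClass_eq_zero_of_isWannierBasis
    (fun U hU hUne => Coarse.infinite_of_isOpen hn hU hUne)
    Coarse.exists_subset_riemannianVolume hX₁ hX₂ hX hρ₁ hρ₂ hK₁ hK₂ hp hΓ hw
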